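/- Let $C(x,r)\subset\mathbb R^2$ denote the circle with centre $x$ and radius $r$, $C^\delta$ the (open) $\delta$-neighbourhood of a circle $C$, $|\cdot|$ Lebesgue measure of a set or cardinality of a finite family, and $d(C(x,r),C(y,s))=|x-y|+|r-s|$. A $\delta$-separated three-parameter family of circles is a set $\mathcal C$ of circles $C(x,r)$ with $x\in[0,1]^2$ and $r\in[1,2]$ such that $d(C,C')>\delta$ for all distinct $C,C'\in\mathcal C$ (such a family is finite). For a finite family $\mathcal A$ of circles let $\mu_\delta^{\mathcal A}=\sum_{C\in\mathcal A}\chi_{C^\delta}$. (a) For every $0<\eta<1$ there is $\delta_0=\delta_0(\eta)>0$ such that for all $0<\delta<\delta_0$ and every nonempty $\delta$-separated three-parameter family of circles $\mathcal C$ there exists $\mathcal A\subset\mathcal C$ with $|\mathcal A|>\eta|\mathcal C|$ and $$\bigl|\{y\in C^\delta : \mu_\delta^{\mathcal A}(y)>\delta^{-4\eta}\lambda^{-1}|\mathcal A|^{2/3}\}\bigr|\le\lambda\,|C^\delta|\qquad\text{for all } C\in\mathcal A,\ 0<\lambda<1.$$ (b) For every $\eta>0$ there is a constant $C_\eta>0$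 such that for all $0<\delta<1$, all measurable $E\subset[0,1]^2$ and all $\lambda>0$, $$\lambda\,|F|^{1/6}\le C_\eta\,\delta^{-\eta}\,|E|^{1/2},\qquad F=\Bigl\{(x,t)\in\mathbb R^2\times[1,2] : \frac{|E\cap C^\delta(x,t)|}{|C^\delta(x,t)|}>\lambda\Bigr\}.$$ That is, the averaging operators $f\mapsto |C^\delta(x,t)|^{-1}\int_{C^\delta(x,t)}f$ satisfy a restricted weak-type $L^2\to L^6$ bound with loss $\delta^{-\eta}$ on functions $\chi_E$, $E\subset[0,1]^2$. -/

import Mathlib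

open MeasureTheory

/-- The Euclidean plane. -/
abbrev Plane : Type := EuclideanSpace ℝ (Fin 2)

/-- A circle `C(x, r)` in the plane, given by its centre `x` and its radius `r`. -/
abbrev PlaneCircle : Type := EuclideanGeometry.Sphere Plane

/-- The annulus `C^δ`: the open `δ`-neighbourhood of the circle `C`. -/
def annulus (δ : ℝ) (C : PlaneCircle) : Set Plane :=
  Metric.thickening δ (C : Set Plane)

/-- The distance `d(C(x, r), C(y, s)) = |x - y| + |r - s|` between circles. -/
noncomputable def circleDist (C C' : PlaneCircle) : ℝ :=
  dist C.center C'.center + |C.radius - C'.radius|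

/-- A `δ`-separated three-parameter family of circles: the centres lie in `[0,1]²`, the radii lie
in `[1,2]`, and any two distinct members are at `circleDist` greater than `δ`.
Such a family is necessarily finite. -/
structure IsSeparatedCircleFamily (δ : ℝ) (𝒞 : Finset PlaneCircle) : Prop where
  center_mem : ∀ C ∈ 𝒞, ∀ i, C.center i ∈ Set.Icc (0 : ℝ) 1
  radius_mem : ∀ C ∈ 𝒞, C.radius ∈ Set.Icc (1 : ℝ) 2
  separated : ∀ C ∈ 𝒞, ∀ C' ∈ 𝒞, C ≠ C' → δ < circleDist C C'

/-- The multiplicity function `μ_δ^𝒜 = ∑_{C ∈ 𝒜} χ_{C^δ}`. -/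
noncomputable def circleMultiplicity (δ : ℝ) (𝒜 : Finset PlaneCircle) (y : Plane) : ℝ :=
  ∑ C ∈ 𝒜, (annulus δ C).indicator (fun _ => (1 : ℝ)) y

/-- The circular mean `(σ_δ * f)(x, t)`: the mean value of `f` over the annulus
`C^δ(x, t)` with respect to Lebesgue measure. -/
noncomputable def circularMean (δ : ℝ) (f : Plane → ℝ) (p : Plane × ℝ) : ℝ :=
  ⨍ y in annulus δ ⟨p.1, p.2⟩, f y

/-- The superlevel set `F = {(x, t) ∈ ℝ² × [1,2] : (σ_δ * χ_E)(x, t) > lam}`. -/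
def circularMeanSuperlevel (δ lam : ℝ) (E : Set Plane) : Set (Plane × ℝ) :=
  {p | p.2 ∈ Set.Icc (1 : ℝ) 2 ∧ lam < circularMean δ (E.indicator fun _ => (1 : ℝ)) p}

/-! ### Volumes of planar regions near circles -/

/-! Both parts rest on one `L²` bound, `exists_sum_interArea_le`: for a `δ`-separated family of `n`
circles with radii in `[1,2]` and centres at mutual distance at most `3/2`, the integral of the
squared multiplicity, which is the sum of the areas of all pairwise intersections of annuli, is `≲
δ^(1-η) n^(5/3)`. For (a), discard the circles whose total intersection with the family is large,
and apply Markov's inequality on each remaining annulus. For (b), Cauchy–Schwarz bounds the size of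
a `δ`-separated subset of a unit block of `F`, hence the volume of `F`.

The `L²` bound starts from `volume_inter_annuli_le`: if the centres are at distance `a` and the
radii differ by `b`, the annuli meet in area `≲ δ² / √((δ + |a - b|)(δ + a + b))`. Sort the circles
into slices whose radii agree up to `δ/2`. Between slices `j` and `k`, `b` is about `R = |j - k|
δ/2`, so `|a - b| ≲ p` says that one centre lies within about `p` of the circle of radius `R` about
the other. This is an incidence problem between points and circles of equal radius, where
Cauchy–Schwarz in the centres suffices (`incidences_pow_six_le`): with slices of sizes `g` and `h`
there are `≲ (p³(R + p)/δ⁴)^(1/6) (gh)^(5/6)` incidences.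

Multiplying by `δ² / √(p(R + p))` leaves at most `δ (gh)^(5/6) (1 + |j - k|)^(-1/3)` up to a
constant, whatever `p` is, so summing over dyadic `p` costs a logarithm. The cube of this kernel has
logarithmic row sums, and a Young inequality with exponents `6/5, 6/5, 3`
(`sum_sum_le_of_pow_six_le`) sums over pairs of slices to `n^(5/3)`. The logarithms are absorbed
into `δ^(-η)`. -/

theorem volume_le_of_forall_abs_sub_le {s : Set ℝ} {c : ℝ}
    (h : ∀ x ∈ s, ∀ y ∈ s, |x - y| ≤ c) : volume s ≤ ENNReal.ofReal c := by
  refine (Real.volume_le_diam s).trans (Metric.ediam_le fun x hx y hy => ?_)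
  rw [edist_dist, Real.dist_eq]
  exact ENNReal.ofReal_le_ofReal (h x hx y hy)

/-- The square root is `(2b)⁻¹`-Lipschitz away from `(-b, b)`. -/
theorem volume_sq_near_le {b q m : ℝ} (hb : 0 < b) (hq : 0 ≤ q) :
    volume {t : ℝ | b ≤ |t| ∧ |t ^ 2 - m| ≤ q} ≤ ENNReal.ofReal (2 * q / b) := by
  have key : ∀ x y : ℝ, b ≤ x → b ≤ y → |x ^ 2 - m| ≤ q → |y ^ 2 - m| ≤ q → |x - y| ≤ q / b := by
    intro x y hx hy h1 h2
    rw [le_div_iff₀ hb]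
    rw [abs_le] at h1 h2
    have h3 : |x - y| * (x + y) ≤ 2 * q := by
      rw [← abs_of_nonneg (by linarith : 0 ≤ x + y), ← abs_mul, abs_le]
      constructor <;> nlinarith
    nlinarith [abs_nonneg (x - y)]
  have hsub : {t : ℝ | b ≤ |t| ∧ |t ^ 2 - m| ≤ q} ⊆
      {t : ℝ | b ≤ t ∧ |t ^ 2 - m| ≤ q} ∪ {t : ℝ | b ≤ -t ∧ |t ^ 2 - m| ≤ q} := by
    rintro t ⟨h1, h2⟩
    rcases le_abs.1 h1 with h | h
    · exact Or.inl ⟨h, h2⟩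
    · exact Or.inr ⟨h, h2⟩
  calc volume {t : ℝ | b ≤ |t| ∧ |t ^ 2 - m| ≤ q}
      ≤ ENNReal.ofReal (q / b) + ENNReal.ofReal (q / b) := by
        refine (measure_mono hsub).trans ((measure_union_le _ _).trans (add_le_add ?_ ?_))
        · exact volume_le_of_forall_abs_sub_le fun x hx y hy => key x y hx.1 hy.1 hx.2 hy.2
        · refine volume_le_of_forall_abs_sub_le fun x hx y hy => ?_
          have := key (-x) (-y) hx.1 hy.1 (by simpa using hx.2) (by simpa using hy.2)
          rwa [show -x - -y = -(x - y) by ring, abs_neg] at this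
    _ = ENNReal.ofReal (2 * q / b) := by
        rw [← ENNReal.ofReal_add (by positivity) (by positivity)]
        congr 1
        ring

/-- If `m ≥ 2h` the set stays away from `0` by `√(m/2)` and the previous Lipschitz bound applies;
otherwise `m + h < 3h` and the interval `|t| ≤ √(m + h)` is already short enough. -/
theorem volume_sq_near_le_sqrt {h m : ℝ} (hh : 0 < h) :
    volume {t : ℝ | |t ^ 2 - m| ≤ h} ≤ ENNReal.ofReal (8 * h / √(m + h)) := by
  rcases le_or_gt (2 * h) m with hm | hm
  · have hs : 0 < √(m / 2) := Real.sqrt_pos.2 (by linarith)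
    have hsub : {t : ℝ | |t ^ 2 - m| ≤ h} ⊆ {t : ℝ | √(m / 2) ≤ |t| ∧ |t ^ 2 - m| ≤ h} := by
      intro t ht
      refine ⟨?_, ht⟩
      rw [Real.sqrt_le_left (abs_nonneg _), sq_abs]
      have := (abs_le.1 (show |t ^ 2 - m| ≤ h from ht)).1
      linarith
    refine (measure_mono hsub).trans ((volume_sq_near_le hs hh.le).trans ?_)
    apply ENNReal.ofReal_le_ofReal
    have h2 : √(m + h) ≤ 2 * √(m / 2) := by
      rw [Real.sqrt_le_left (by positivity), mul_pow, Real.sq_sqrt (by linarith)]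
      linarith
    have h3 : 0 < √(m + h) := Real.sqrt_pos.2 (by linarith)
    rw [div_le_div_iff₀ hs h3]
    nlinarith
  -- For `m + h ≤ 0` the square root is `0` and division by it yields `0`, so the set must really be
  -- null: it is empty, or contained in a point.
  · rcases lt_or_ge (m + h) 0 with h0 | h0
    · have : {t : ℝ | |t ^ 2 - m| ≤ h} = ∅ := by
        ext t
        simp only [Set.mem_ofPred_eq, Set.mem_empty_iff_false, iff_false, not_le]
        rw [lt_abs]
        left
        nlinarith [sq_nonneg t]
      rw [this]
      simp
    · have hsub : ∀ t ∈ {t : ℝ | |t ^ 2 - m| ≤ h}, |t| ≤ √(m + h) := by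
        intro t ht
        apply Real.abs_le_sqrt
        have := (abs_le.1 (show |t ^ 2 - m| ≤ h from ht)).2
        linarith
      refine (volume_le_of_forall_abs_sub_le (c := 2 * √(m + h)) fun x hx y hy => ?_).trans
        (ENNReal.ofReal_le_ofReal ?_)
      · have := abs_sub x y
        have := hsub x hx
        have := hsub y hy
        linarith
      · rcases h0.eq_or_lt with h0 | h0
        · rw [← h0]
          simp
        · rw [le_div_iff₀ (Real.sqrt_pos.2 h0), mul_assoc, Real.mul_self_sqrt h0.le]
          linarith

/-- A region fibred over `T` whose fibres are pieces of an annulus transversal to the fibres. -/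
theorem volume_prod_annulus_le {T : Set ℝ} (hT : MeasurableSet T) {b q Q : ℝ} (hb : 0 < b)
    (hq : 0 ≤ q) :
    volume {p : ℝ × ℝ | p.1 ∈ T ∧ b ≤ |p.2| ∧ |p.1 ^ 2 + p.2 ^ 2 - Q| ≤ q} ≤
      volume T * ENNReal.ofReal (2 * q / b) := by
  have hmeas : MeasurableSet {p : ℝ × ℝ | p.1 ∈ T ∧ b ≤ |p.2| ∧ |p.1 ^ 2 + p.2 ^ 2 - Q| ≤ q} := by
    have h1 : Measurable fun p : ℝ × ℝ => |p.2| := by fun_prop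
    have h2 : Measurable fun p : ℝ × ℝ => |p.1 ^ 2 + p.2 ^ 2 - Q| := by fun_prop
    exact (measurable_fst hT).inter
      ((measurableSet_le measurable_const h1).inter (measurableSet_le h2 measurable_const))
  rw [Measure.volume_eq_prod, Measure.prod_apply hmeas]
  calc ∫⁻ x, volume (Prod.mk x ⁻¹' {p : ℝ × ℝ | p.1 ∈ T ∧ b ≤ |p.2| ∧ |p.1 ^ 2 + p.2 ^ 2 - Q| ≤ q})
      ≤ ∫⁻ x, T.indicator (fun _ => ENNReal.ofReal (2 * q / b)) x := by
        refine lintegral_mono fun x => ?_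
        by_cases hx : x ∈ T
        · rw [Set.indicator_of_mem hx]
          refine le_trans (measure_mono ?_) (volume_sq_near_le (m := Q - x ^ 2) hb hq)
          rintro y ⟨-, h2, h3⟩
          refine ⟨h2, ?_⟩
          rwa [show y ^ 2 - (Q - x ^ 2) = x ^ 2 + y ^ 2 - Q by ring]
        · simp [hx]
    _ = volume T * ENNReal.ofReal (2 * q / b) := by
        rw [lintegral_indicator hT, setLIntegral_const, mul_comm]

/-! ### Orthonormal coordinates along the line of centres, and intersections of annuli. -/

/-- The coordinate of `y` along `e`, with origin `x`. -/
def alongCoord (e x y : Plane) : ℝ := e 0 * (y 0 - x 0) + e 1 * (y 1 - x 1)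

/-- The coordinate of `y` orthogonal to `e`, with origin `x`. -/
def acrossCoord (e x y : Plane) : ℝ := e 0 * (y 1 - x 1) - e 1 * (y 0 - x 0)

theorem plane_dist_sq (x y : Plane) : dist x y ^ 2 = (x 0 - y 0) ^ 2 + (x 1 - y 1) ^ 2 := by
  rw [EuclideanSpace.dist_eq, Real.sq_sqrt (by positivity)]
  simp [Fin.sum_univ_two, Real.dist_eq]

theorem along_sq_add_across_sq {e : Plane} (he : e 0 ^ 2 + e 1 ^ 2 = 1) (x y : Plane) :
    alongCoord e x y ^ 2 + acrossCoord e x y ^ 2 = dist y x ^ 2 := by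
  rw [plane_dist_sq, alongCoord, acrossCoord]
  linear_combination ((y 0 - x 0) ^ 2 + (y 1 - x 1) ^ 2) * he

theorem measurePreserving_frame {e : Plane} (he : e 0 ^ 2 + e 1 ^ 2 = 1) (x : Plane) :
    MeasurePreserving (fun y : Plane => (alongCoord e x y, acrossCoord e x y)) := by
  -- The frame is `e` and its quarter turn; the two coordinates are those of `y - x` in this basis.
  have hon : Orthonormal ℝ (![e, !₂[-e 1, e 0]] : Fin 2 → Plane) := by
    rw [orthonormal_iff_ite]
    intro i j
    fin_cases i <;> fin_cases j <;>
      simp [PiLp.inner_apply, Fin.sum_univ_two, -inner_self_eq_norm_sq_to_K] <;>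
        linarith
  obtain ⟨b, hb⟩ := Orthonormal.exists_orthonormalBasis_extension_of_card_eq (𝕜 := ℝ) (E := Plane)
    (ι := Fin 2) (by simp) (v := ![e, !₂[-e 1, e 0]]) (s := Set.univ)
    (hon.comp _ Subtype.val_injective)
  have h1 := (volume_preserving_finTwoArrow ℝ).comp
    ((PiLp.volume_preserving_ofLp (Fin 2)).comp
      (b.measurePreserving_repr.comp (measurePreserving_sub_right volume x)))
  have hfun : (fun y : Plane => (alongCoord e x y, acrossCoord e x y)) =
      MeasurableEquiv.finTwoArrow ∘ WithLp.ofLp ∘ b.repr ∘ fun y => y - x := by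
    funext y
    ext
    · simp [MeasurableEquiv.finTwoArrow, OrthonormalBasis.repr_apply_apply, hb, alongCoord,
        PiLp.inner_apply, Fin.sum_univ_two]
      ring
    · simp [MeasurableEquiv.finTwoArrow, OrthonormalBasis.repr_apply_apply, hb, acrossCoord,
        PiLp.inner_apply, Fin.sum_univ_two]
      ring
  rw [hfun]
  exact h1

theorem volume_along_le {e : Plane} (he : e 0 ^ 2 + e 1 ^ 2 = 1) (x : Plane) {T : Set ℝ}
    (hT : MeasurableSet T) {b q Q : ℝ} (hb : 0 < b) (hq : 0 ≤ q) :
    volume {y : Plane | alongCoord e x y ∈ T ∧ b ≤ |acrossCoord e x y| ∧ |dist y x ^ 2 - Q| ≤ q} ≤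
      volume T * ENNReal.ofReal (2 * q / b) := by
  refine le_trans (measure_mono ?_) (((measurePreserving_frame he x).measure_preimage_le _).trans
    (volume_prod_annulus_le hT hb hq (Q := Q)))
  rintro y ⟨h1, h2, h3⟩
  refine ⟨h1, h2, ?_⟩
  simp only
  rwa [along_sq_add_across_sq he]

theorem volume_across_le {e : Plane} (he : e 0 ^ 2 + e 1 ^ 2 = 1) (x : Plane) {T : Set ℝ}
    (hT : MeasurableSet T) {b q Q : ℝ} (hb : 0 < b) (hq : 0 ≤ q) :
    volume {y : Plane | acrossCoord e x y ∈ T ∧ b ≤ |alongCoord e x y| ∧ |dist y x ^ 2 - Q| ≤ q} ≤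
      volume T * ENNReal.ofReal (2 * q / b) := by
  have he' : (!₂[-e 1, e 0] : Plane) 0 ^ 2 + (!₂[-e 1, e 0] : Plane) 1 ^ 2 = 1 := by
    simp
    linarith
  refine le_trans (measure_mono ?_) (volume_along_le he' x hT hb hq (Q := Q))
  rintro y ⟨h1, h2, h3⟩
  have e1 : alongCoord !₂[-e 1, e 0] x y = acrossCoord e x y := by
    simp [alongCoord, acrossCoord]
    ring
  have e2 : acrossCoord !₂[-e 1, e 0] x y = -alongCoord e x y := by
    simp [alongCoord, acrossCoord]
    ring
  refine ⟨by rwa [e1], by rwa [e2, abs_neg], h3⟩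

theorem exists_direction {x x' : Plane} (h : x ≠ x') :
    ∃ e : Plane, e 0 ^ 2 + e 1 ^ 2 = 1 ∧ (∀ y, acrossCoord e x y = acrossCoord e x' y) ∧
      ∀ y, alongCoord e x y = alongCoord e x' y + dist x x' := by
  have hd : 0 < dist x x' := dist_pos.2 h
  have hsq := plane_dist_sq x x'
  refine ⟨!₂[(x' 0 - x 0) / dist x x', (x' 1 - x 1) / dist x x'], ?_, ?_, ?_⟩
  · simp
    field_simp
    linarith
  · intro y
    simp [acrossCoord]
    field_simp
    ring
  · intro y
    simp [alongCoord]
    field_simp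
    linarith

theorem volume_dist_near_le (x : Plane) {r ρ : ℝ} (hr : 0 < r) (hρ : 0 ≤ ρ) :
    volume {y : Plane | |dist y x - r| ≤ ρ} ≤ ENNReal.ofReal (16 * (r + ρ) * ρ) := by
  rcases le_or_gt r ρ with h | h
  · have hsub : {y : Plane | |dist y x - r| ≤ ρ} ⊆ Metric.closedBall x (r + ρ) := by
      intro y hy
      have := (abs_le.1 (show |dist y x - r| ≤ ρ from hy)).2
      rw [Metric.mem_closedBall]
      linarith
    refine (measure_mono hsub).trans ?_
    rw [EuclideanSpace.volume_closedBall_fin_two, ← ENNReal.ofReal_pow (by positivity),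
      ← ENNReal.ofReal_mul (by positivity)]
    apply ENNReal.ofReal_le_ofReal
    have h4 := Real.pi_le_four
    have : (r + ρ) ^ 2 * Real.pi ≤ (r + ρ) ^ 2 * 4 := by gcongr
    nlinarith
  · have hsub : {y : Plane | |dist y x - r| ≤ ρ} ⊆
        Metric.closedBall x (r + ρ) \ Metric.ball x (r - ρ) := by
      intro y hy
      have := abs_le.1 (show |dist y x - r| ≤ ρ from hy)
      simp only [Set.mem_sdiff, Metric.mem_closedBall, Metric.mem_ball, not_lt]
      constructor <;> linarith
    refine (measure_mono hsub).trans ?_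
    rw [measure_sdiff ((Metric.ball_subset_ball (by linarith)).trans Metric.ball_subset_closedBall)
      Metric.isOpen_ball.measurableSet.nullMeasurableSet measure_ball_lt_top.ne,
      EuclideanSpace.volume_closedBall_fin_two, EuclideanSpace.volume_ball_fin_two,
      ← ENNReal.ofReal_pow (by positivity), ← ENNReal.ofReal_mul (by positivity),
      ← ENNReal.ofReal_pow (by linarith), ← ENNReal.ofReal_mul (by positivity),
      ← ENNReal.ofReal_sub _ (by positivity)]
    apply ENNReal.ofReal_le_ofReal
    have h4 := Real.pi_le_four
    have : (4 * (r * ρ)) * Real.pi ≤ (4 * (r * ρ)) * 4 := by gcongr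
    nlinarith

theorem volume_abs_sub_le (c h : ℝ) :
    volume {t : ℝ | |t - c| ≤ h} = ENNReal.ofReal (2 * h) := by
  have : {t : ℝ | |t - c| ≤ h} = Metric.closedBall c h := by
    ext t
    simp [Real.dist_eq]
  rw [this, Real.volume_closedBall]

theorem measurableSet_abs_sub_le (c h : ℝ) : MeasurableSet {t : ℝ | |t - c| ≤ h} := by
  have h1 : Measurable fun t : ℝ => |t - c| := by fun_prop
  exact measurableSet_le h1 measurable_const

theorem measurableSet_abs_sq_sub_le (c h : ℝ) : MeasurableSet {t : ℝ | |t ^ 2 - c| ≤ h} := by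
  have h1 : Measurable fun t : ℝ => |t ^ 2 - c| := by fun_prop
  exact measurableSet_le h1 measurable_const

theorem le_abs_of_sq_le_sq {b v : ℝ} (hb : 0 ≤ b) (h : b ^ 2 ≤ v ^ 2) : b ≤ |v| := by
  rw [← abs_of_nonneg hb]
  exact sq_le_sq.1 h

/-- The intersection of two annuli of equal radius is a pair of small transversal pieces. -/
theorem volume_inter_annuli_same_radius_le {x x' : Plane} {R ρ : ℝ} (hρ : 0 < ρ)
    (hR : 100 * ρ ≤ R) (hx : 0 < dist x x') (hx2 : dist x x' ≤ 3 / 2 * R) :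
    volume {y : Plane | |dist y x - R| ≤ 2 * ρ ∧ |dist y x' - R| ≤ 2 * ρ} ≤
      ENNReal.ofReal (4000 * (ρ ^ 2 * R / dist x x')) := by
  have hR0 : 0 < R := by linarith
  set s := dist x x' with hs
  -- For close centres the area of a single annulus, of order `ρR`, is already within the bound.
  rcases le_or_gt s (100 * ρ) with h | h
  · refine (measure_mono (fun y hy => hy.1)).trans
      ((volume_dist_near_le x (by linarith) (by linarith)).trans (ENNReal.ofReal_le_ofReal ?_))
    rw [mul_div_assoc', le_div_iff₀ hx]
    have h0 : 0 ≤ 16 * (R + 2 * ρ) * (2 * ρ) := by positivity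
    have h1 : 16 * (R + 2 * ρ) * (2 * ρ) * s ≤ 16 * (R + 2 * ρ) * (2 * ρ) * (100 * ρ) :=
      mul_le_mul_of_nonneg_left h h0
    nlinarith [mul_pos hρ hρ]
  · obtain ⟨e, he, hac, hal⟩ := exists_direction (dist_pos.1 hx)
    have hsub : {y : Plane | |dist y x - R| ≤ 2 * ρ ∧ |dist y x' - R| ≤ 2 * ρ} ⊆
        {y : Plane | alongCoord e x y ∈ {t | |t - s / 2| ≤ 5 * ρ * R / s} ∧
          R / 4 ≤ |acrossCoord e x y| ∧ |dist y x ^ 2 - R ^ 2| ≤ 5 * ρ * R} := by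
      rintro y ⟨h1, h2⟩
      have h3 : ∀ D : ℝ, |D - R| ≤ 2 * ρ → |D ^ 2 - R ^ 2| ≤ 5 * ρ * R := by
        intro D hD
        rw [abs_le] at hD ⊢
        constructor <;> nlinarith
      have h4 := h3 _ h1
      have h5 := h3 _ h2
      have e1 := along_sq_add_across_sq he x y
      have e2 := along_sq_add_across_sq he x' y
      rw [← hac] at e2
      have e3 := hal y
      rw [← hs] at e3
      set u := alongCoord e x y
      set v := acrossCoord e x y
      have e4 : alongCoord e x' y = u - s := by linarith
      rw [e4] at e2
      -- Subtracting the two circle equations removes the quadratic terms and confines `u` to a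
      -- neighbourhood of the radical axis.
      have h6 : |u - s / 2| ≤ 5 * ρ * R / s := by
        rw [le_div_iff₀ hx]
        nth_rewrite 2 [← abs_of_pos hx]
        rw [← abs_mul]
        rw [abs_le] at h4 h5 ⊢
        constructor <;> nlinarith
      refine ⟨h6, ?_, h4⟩
      have h7 : |u| ≤ 4 / 5 * R := by
        have : 5 * ρ * R / s ≤ R / 20 := by
          rw [div_le_div_iff₀ hx (by norm_num)]
          nlinarith
        rw [abs_le] at h6 ⊢
        constructor <;> linarith
      have h8 : u ^ 2 ≤ (4 / 5 * R) ^ 2 := sq_le_sq' (by linarith [(abs_le.1 h7).1]) (abs_le.1 h7).2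
      apply le_abs_of_sq_le_sq (by linarith)
      have := (abs_le.1 h4).1
      nlinarith
    refine (measure_mono hsub).trans ((volume_along_le he x (measurableSet_abs_sub_le _ _)
      (by linarith) (by positivity)).trans ?_)
    rw [volume_abs_sub_le, ← ENNReal.ofReal_mul (by positivity)]
    apply ENNReal.ofReal_le_ofReal
    have : 2 * (5 * ρ * R / s) * (2 * (5 * ρ * R) / (R / 4)) = 400 * (ρ ^ 2 * R / s) := by
      field_simp
      ring
    rw [this]
    gcongr
    norm_num

/-- In the frame pointing from `y` to `x`, a ball about `y` small compared with `R` confines the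
orthogonal coordinate to length `4s`, and the annulus there is transversal to the radial direction.
-/
theorem volume_annulus_inter_ball_le {x y : Plane} {R ρ s : ℝ} (hρ : 0 < ρ)
    (hR : 100 * ρ ≤ R) (hy : |dist y x - R| ≤ ρ) (hs : ρ ≤ s) :
    volume {z : Plane | |dist z x - R| ≤ 2 * ρ ∧ dist z y ≤ 2 * s} ≤
      ENNReal.ofReal (400 * (ρ * s)) := by
  have hR0 : 0 < R := by linarith
  rcases le_or_gt R (8 * s) with h | h
  · refine (measure_mono (fun y hy => hy.1)).trans
      ((volume_dist_near_le x (by linarith) (by linarith)).trans (ENNReal.ofReal_le_ofReal ?_))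
    nlinarith
  · have hxy : y ≠ x := by
      rintro rfl
      simp at hy
      linarith [abs_le.1 hy]
    obtain ⟨e, he, hac, hal⟩ := exists_direction hxy
    have hsub : {z : Plane | |dist z x - R| ≤ 2 * ρ ∧ dist z y ≤ 2 * s} ⊆
        {z : Plane | acrossCoord e x z ∈ {t | |t - 0| ≤ 2 * s} ∧
          R / 4 ≤ |alongCoord e x z| ∧ |dist z x ^ 2 - R ^ 2| ≤ 5 * ρ * R} := by
      rintro z ⟨h1, h2⟩
      have e2 := along_sq_add_across_sq he y z
      rw [hac] at e2
      have e3 := hal z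
      have h3 : |acrossCoord e x z| ≤ 2 * s := by
        apply abs_le_of_sq_le_sq _ (by linarith)
        nlinarith [dist_nonneg (x := z) (y := y)]
      have h4 : |alongCoord e y z| ≤ 2 * s := by
        apply abs_le_of_sq_le_sq _ (by linarith)
        nlinarith [dist_nonneg (x := z) (y := y)]
      refine ⟨by simpa using h3, ?_, ?_⟩
      · rw [abs_le] at hy h4
        rw [le_abs]
        right
        linarith
      · rw [abs_le] at h1 ⊢
        constructor <;> nlinarith
    refine (measure_mono hsub).trans ((volume_across_le he x (measurableSet_abs_sub_le _ _)
      (by linarith) (by positivity)).trans ?_)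
    rw [volume_abs_sub_le, ← ENNReal.ofReal_mul (by linarith)]
    apply ENNReal.ofReal_le_ofReal
    have : 2 * (2 * s) * (2 * (5 * ρ * R) / (R / 4)) = 160 * (ρ * s) := by
      field_simp
      ring
    rw [this]
    have : 0 < ρ * s := by nlinarith
    linarith

/-- A separated set of points has few elements whose neighbourhoods lie in a small set. -/
theorem card_le_of_separated {ι : Type*} (P : Finset ι) (f : ι → Plane) {δ V : ℝ} (hδ : 0 < δ)
    (hV : 0 ≤ V) (hsep : ∀ p ∈ P, ∀ q ∈ P, p ≠ q → δ ≤ dist (f p) (f q)) (W : Set Plane)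
    (hW : ∀ p ∈ P, ∀ z, dist z (f p) < δ / 2 → z ∈ W) (hvol : volume W ≤ ENNReal.ofReal V) :
    (P.card : ℝ) ≤ 2 * V / δ ^ 2 := by
  have hdisj : (P : Set ι).PairwiseDisjoint fun p => Metric.ball (f p) (δ / 2) := by
    intro p hp q hq hpq
    apply Metric.ball_disjoint_ball
    linarith [hsep p hp q hq hpq]
  have h1 : volume (⋃ p ∈ P, Metric.ball (f p) (δ / 2)) ≤ ENNReal.ofReal V := by
    refine (measure_mono ?_).trans hvol
    exact Set.iUnion₂_subset fun p hp z hz => hW p hp z hz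
  rw [measure_biUnion_finset hdisj fun p _ => Metric.isOpen_ball.measurableSet] at h1
  simp only [EuclideanSpace.volume_ball_fin_two, Finset.sum_const, nsmul_eq_mul] at h1
  rw [← ENNReal.ofReal_pow (by positivity), ← ENNReal.ofReal_mul (by positivity),
    ← ENNReal.ofReal_natCast, ← ENNReal.ofReal_mul (by positivity),
    ENNReal.ofReal_le_ofReal_iff hV] at h1
  rw [le_div_iff₀ (by positivity)]
  have h3 : (P.card : ℝ) * ((δ / 2) ^ 2 * 2) ≤ P.card * ((δ / 2) ^ 2 * Real.pi) := by
    gcongr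
    exact Real.two_le_pi
  nlinarith

/-- Subtracting the equations determines `u` up to `5δ/a`. Away from the axis of centres (`|v| ≥
1/4`) this is used as it stands, with the annulus thin in `v`; near the axis it is converted into a
condition on `v²`, with the annulus thin in `u`. -/
theorem inter_annuli_coordinates {a r s δ u v : ℝ} (hδ : 0 < δ) (hδ2 : δ < 1 / 100)
    (hr : r ∈ Set.Icc (1 : ℝ) 2) (haδ : 4 * δ < a) (hx : a ≤ 3 / 2)
    (h4 : |u ^ 2 + v ^ 2 - r ^ 2| ≤ 5 * δ) (h5 : |(u - a) ^ 2 + v ^ 2 - s ^ 2| ≤ 5 * δ) :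
    (|u - (r ^ 2 - s ^ 2 + a ^ 2) / (2 * a)| ≤ 5 * δ / a ∧ 1 / 4 ≤ |v|) ∨
      (|v ^ 2 - (r ^ 2 - ((r ^ 2 - s ^ 2 + a ^ 2) / (2 * a)) ^ 2)| ≤ 48 * δ / a ∧
        1 / 2 ≤ |u|) := by
  obtain ⟨hr1, hr2⟩ := hr
  have ha1 : 0 < a := by linarith
  set C := (r ^ 2 - s ^ 2 + a ^ 2) / (2 * a) with hC
  have hca : C * (2 * a) = r ^ 2 - s ^ 2 + a ^ 2 := by
    rw [hC]
    field_simp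
  have h6 : |u - C| ≤ 5 * δ / a := by
    rw [le_div_iff₀ ha1]
    rw [show |u - C| * a = |(u - C) * a| by rw [abs_mul, abs_of_pos ha1]]
    rw [abs_le] at h4 h5 ⊢
    constructor <;> nlinarith
  rcases le_or_gt (1 / 4) |v| with hv | hv
  · exact Or.inl ⟨h6, hv⟩
  · have hv2 : v ^ 2 ≤ (1 / 4) ^ 2 := by
      rw [← sq_abs]
      exact pow_le_pow_left₀ (abs_nonneg v) hv.le 2
    refine Or.inr ⟨?_, ?_⟩
    · have h7 : |u| ≤ 3 := by
        apply abs_le_of_sq_le_sq _ (by norm_num)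
        nlinarith [(abs_le.1 h4).2]
      have h8 : 5 * δ / a ≤ 5 / 4 := by
        rw [div_le_iff₀ ha1]
        linarith
      have h9 : |u + C| ≤ 8 := by
        rw [abs_le] at h6 h7 ⊢
        constructor <;> linarith
      have h10 : |u ^ 2 - C ^ 2| ≤ 40 * δ / a := by
        rw [show u ^ 2 - C ^ 2 = (u - C) * (u + C) by ring, abs_mul]
        calc |u - C| * |u + C| ≤ 5 * δ / a * 8 := by gcongr
          _ = 40 * δ / a := by ring
      have h11 : 5 * δ ≤ 8 * δ / a := by
        rw [le_div_iff₀ ha1]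
        nlinarith
      have h12 : 48 * δ / a = 40 * δ / a + 8 * δ / a := by
        ring
      show |v ^ 2 - (r ^ 2 - C ^ 2)| ≤ 48 * δ / a
      rw [abs_le] at h10 h4 ⊢
      constructor <;> linarith
    · apply le_abs_of_sq_le_sq (by norm_num)
      nlinarith [(abs_le.1 h4).1]

/-- The squared height `r² - c²` of the intersection points above the line of centres satisfies
`4a²(r² - c²) = (a² - (r-s)²)((r+s)² - a²)`. Since `a ≤ 3/2` there is no external tangency, and the
last factor is bounded below. If `b > a` the height term is negative, but only of order `δa`, which
the `48δ/a` outweighs. -/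
theorem tangency_le_offset {a b r s δ : ℝ} (hδ : 0 < δ) (hr : r ∈ Set.Icc (1 : ℝ) 2)
    (hs : s ∈ Set.Icc (1 : ℝ) 2) (haδ : 4 * δ < a) (hx : a ≤ 3 / 2) (hb1 : b ≤ 1)
    (hba : b ≤ a + 2 * δ) (hb0 : 0 ≤ b) (hbsq : b ^ 2 = (r - s) ^ 2) :
    (δ + |a - b|) * (δ + a + b) / 4 ≤
      a ^ 2 * (r ^ 2 - ((r ^ 2 - s ^ 2 + a ^ 2) / (2 * a)) ^ 2 + 48 * δ / a) := by
  obtain ⟨hr1, hr2⟩ := hr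
  obtain ⟨hs1, hs2⟩ := hs
  have ha1 : 0 < a := by linarith
  have hm4 : a ^ 2 * (r ^ 2 - ((r ^ 2 - s ^ 2 + a ^ 2) / (2 * a)) ^ 2) = (a - b) * (a + b) * ((s + r - a) * (r + a + s)) / 4 := by
    have : (a - b) * (a + b) = a ^ 2 - (r - s) ^ 2 := by linear_combination -hbsq
    rw [this]
    field_simp
    ring
  have hah : a ^ 2 * (48 * δ / a) = 48 * δ * a := by
    field_simp
  rw [mul_add (a ^ 2), hm4, hah]
  rcases le_or_gt b a with hab | hab
  · rw [abs_of_nonneg (by linarith)]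
    have h1 : 1 ≤ (s + r - a) * (r + a + s) := by nlinarith
    have h2 : 0 ≤ (a - b) * (a + b) := mul_nonneg (by linarith) (by linarith)
    nlinarith
  · rw [abs_of_neg (by linarith)]
    have h1 : (s + r - a) * (r + a + s) ≤ 4 * (11 / 2) := by
      apply mul_le_mul <;> linarith
    have h0 : 0 ≤ (s + r - a) * (r + a + s) := mul_nonneg (by linarith) (by linarith)
    have h2 : (b - a) * (a + b) ≤ 2 * δ * (5 / 2 * a) := by
      apply mul_le_mul <;> linarith
    have h3 : (b - a) * (a + b) * ((s + r - a) * (r + a + s)) ≤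
        2 * δ * (5 / 2 * a) * (4 * (11 / 2)) :=
      mul_le_mul h2 h1 h0 (by positivity)
    have h4 : (δ + -(a - b)) * (δ + a + b) ≤ (3 * δ) * (11 / 4 * a) := by
      apply mul_le_mul <;> linarith
    nlinarith [mul_pos hδ ha1]

theorem inter_annuli_arith {a M S δ : ℝ} (ha : 0 < a) (hM : 0 < M) (hS : 0 < S)
    (h1 : S ≤ 2 * (a * M)) (h2 : S ≤ 4 * a) :
    2 * (5 * δ / a) * (2 * (5 * δ) / (1 / 4)) + 8 * (48 * δ / a) / M * (2 * (5 * δ) / (1 / 2)) ≤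
      20000 * (δ ^ 2 / S) := by
  have h3 : δ ^ 2 / a ≤ 4 * (δ ^ 2 / S) := by
    rw [mul_div_assoc', div_le_div_iff₀ ha hS]
    nlinarith [sq_nonneg δ]
  have h4 : δ ^ 2 / (a * M) ≤ 2 * (δ ^ 2 / S) := by
    rw [mul_div_assoc', div_le_div_iff₀ (by positivity) hS]
    nlinarith [sq_nonneg δ]
  have h5 : 0 ≤ δ ^ 2 / S := by positivity
  have h6 : 2 * (5 * δ / a) * (2 * (5 * δ) / (1 / 4)) +
      8 * (48 * δ / a) / M * (2 * (5 * δ) / (1 / 2)) =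
      400 * (δ ^ 2 / a) + 7680 * (δ ^ 2 / (a * M)) := by
    field_simp
    ring
  linarith

/-- The intersection of two annuli of thickness `δ`, in terms of the distance and of the degree of
internal tangency of the two circles. -/
theorem volume_inter_annuli_le {x x' : Plane} {r s δ : ℝ} (hδ : 0 < δ) (hδ1 : δ < 1)
    (hr : r ∈ Set.Icc (1 : ℝ) 2) (hs : s ∈ Set.Icc (1 : ℝ) 2) (hx : dist x x' ≤ 3 / 2) :
    volume {y : Plane | |dist y x - r| ≤ δ ∧ |dist y x' - s| ≤ δ} ≤
      ENNReal.ofReal (20000 * (δ ^ 2 /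
        √((δ + |dist x x' - abs (r - s)|) * (δ + dist x x' + |r - s|)))) := by
  obtain ⟨hr1, hr2⟩ := hr
  obtain ⟨hs1, hs2⟩ := hs
  have ha0 : 0 ≤ dist x x' := dist_nonneg
  set a := dist x x' with ha
  have hrs0 := abs_nonneg (r - s)
  have hrs1 : |r - s| ≤ 1 := abs_le.2 ⟨by linarith, by linarith⟩
  set b := |r - s| with hb
  have hΔ0 := abs_nonneg (a - b)
  have hpos : 0 < (δ + |a - b|) * (δ + a + b) := by positivity
  have hsqrt : 0 < √((δ + |a - b|) * (δ + a + b)) := Real.sqrt_pos.2 hpos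
  -- In this regime the claimed bound is at least a fixed multiple of `δ`, large enough for the area
  -- of one annulus.
  have trivial_bound : (δ + |a - b|) * (δ + a + b) ≤ (400 * δ) ^ 2 →
      volume {y : Plane | |dist y x - r| ≤ δ ∧ |dist y x' - s| ≤ δ} ≤
      ENNReal.ofReal (20000 * (δ ^ 2 / √((δ + |a - b|) * (δ + a + b)))) := by
    intro h
    refine (measure_mono (fun y hy => hy.1)).trans
      ((volume_dist_near_le x (by linarith) (by linarith)).trans (ENNReal.ofReal_le_ofReal ?_))
    rw [mul_div_assoc', le_div_iff₀ hsqrt]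
    have h1 : √((δ + |a - b|) * (δ + a + b)) ≤ 400 * δ := by
      rwa [Real.sqrt_le_left (by positivity)]
    calc 16 * (r + δ) * δ * √((δ + |a - b|) * (δ + a + b)) ≤ 16 * (2 + 1) * δ * (400 * δ) := by
          gcongr
      _ ≤ 20000 * δ ^ 2 := by nlinarith
  have hΔ1 : |a - b| ≤ 3 / 2 := abs_le.2 ⟨by linarith, by linarith⟩
  rcases le_or_gt (1 / 100) δ with hδ2 | hδ2
  · apply trivial_bound
    have : (δ + |a - b|) * (δ + a + b) ≤ (1 + 3 / 2) * (1 + 3 / 2 + 1) := by gcongr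
    nlinarith
  rcases Set.eq_empty_or_nonempty {y : Plane | |dist y x - r| ≤ δ ∧ |dist y x' - s| ≤ δ} with
    hemp | ⟨y₀, hy1, hy2⟩
  · rw [hemp]
    simp
  -- Annuli that meet cannot be nested with a gap.
  have hba : b ≤ a + 2 * δ := by
    have h1 := dist_triangle y₀ x x'
    have h2 := dist_triangle y₀ x' x
    rw [dist_comm x' x] at h2
    rw [abs_le] at hy1 hy2
    exact abs_le.2 ⟨by linarith, by linarith⟩
  rcases le_or_gt a (4 * δ) with haδ | haδ
  · apply trivial_bound
    have h1 : |a - b| ≤ 6 * δ := abs_le.2 ⟨by linarith, by linarith⟩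
    have : (δ + |a - b|) * (δ + a + b) ≤ (δ + 6 * δ) * (δ + 4 * δ + 6 * δ) := by
      gcongr
      linarith
    nlinarith
  have ha1 : 0 < a := by linarith
  obtain ⟨e, he, hac, hal⟩ := exists_direction (dist_pos.1 ha1)
  set c := (r ^ 2 - s ^ 2 + a ^ 2) / (2 * a) with hc
  set m := r ^ 2 - c ^ 2 with hm
  set h := 48 * δ / a with hh
  have hh0 : 0 < h := by positivity
  have hsub : {y : Plane | |dist y x - r| ≤ δ ∧ |dist y x' - s| ≤ δ} ⊆
      {y : Plane | alongCoord e x y ∈ {t | |t - c| ≤ 5 * δ / a} ∧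
        1 / 4 ≤ |acrossCoord e x y| ∧ |dist y x ^ 2 - r ^ 2| ≤ 5 * δ} ∪
      {y : Plane | acrossCoord e x y ∈ {t | |t ^ 2 - m| ≤ h} ∧
        1 / 2 ≤ |alongCoord e x y| ∧ |dist y x ^ 2 - r ^ 2| ≤ 5 * δ} := by
    rintro y ⟨h1, h2⟩
    have h3 : ∀ D t : ℝ, 1 ≤ t → t ≤ 2 → |D - t| ≤ δ → |D ^ 2 - t ^ 2| ≤ 5 * δ := by
      intro D t _ _ hD
      rw [abs_le] at hD ⊢
      constructor <;> nlinarith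
    have h4 := h3 _ _ hr1 hr2 h1
    have h5 := h3 _ _ hs1 hs2 h2
    have e1 := along_sq_add_across_sq he x y
    have e2 := along_sq_add_across_sq he x' y
    rw [← hac] at e2
    have e3 := hal y
    rw [← ha] at e3
    set u := alongCoord e x y
    set v := acrossCoord e x y
    have e4 : alongCoord e x' y = u - a := by linarith
    rw [e4] at e2
    rcases inter_annuli_coordinates hδ hδ2 ⟨hr1, hr2⟩ haδ hx (by rwa [e1]) (by rwa [e2]) with
      ⟨h6, h7⟩ | ⟨h6, h7⟩
    · exact Or.inl ⟨h6, h7, h4⟩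
    · exact Or.inr ⟨h6, h7, h4⟩
  have hlow : (δ + |a - b|) * (δ + a + b) / 4 ≤ a ^ 2 * (m + h) :=
    tangency_le_offset hδ ⟨hr1, hr2⟩ ⟨hs1, hs2⟩ haδ hx hrs1 hba hrs0 (sq_abs _)
  have hmh : 0 < m + h := by
    by_contra hneg
    nlinarith [sq_nonneg a]
  have hsq1 : √((δ + |a - b|) * (δ + a + b)) ≤ 2 * (a * √(m + h)) := by
    rw [Real.sqrt_le_left (by positivity), mul_pow, mul_pow, Real.sq_sqrt hmh.le]
    linarith
  have hsq2 : √((δ + |a - b|) * (δ + a + b)) ≤ 4 * a := by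
    rw [Real.sqrt_le_left (by positivity)]
    have h1 : |a - b| ≤ 3 / 2 * a := abs_le.2 ⟨by linarith, by linarith⟩
    have : (δ + |a - b|) * (δ + a + b) ≤ (a / 4 + 3 / 2 * a) * (a / 4 + a + 3 / 2 * a) := by
      gcongr <;> linarith
    nlinarith
  calc volume {y : Plane | |dist y x - r| ≤ δ ∧ |dist y x' - s| ≤ δ}
      ≤ volume {t : ℝ | |t - c| ≤ 5 * δ / a} * ENNReal.ofReal (2 * (5 * δ) / (1 / 4)) +
        volume {t : ℝ | |t ^ 2 - m| ≤ h} * ENNReal.ofReal (2 * (5 * δ) / (1 / 2)) := by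
        refine (measure_mono hsub).trans ((measure_union_le _ _).trans (add_le_add ?_ ?_))
        · exact volume_along_le he x (measurableSet_abs_sub_le _ _) (by norm_num) (by positivity)
        · exact volume_across_le he x (measurableSet_abs_sq_sub_le _ _) (by norm_num)
            (by positivity)
    _ ≤ ENNReal.ofReal (2 * (5 * δ / a)) * ENNReal.ofReal (2 * (5 * δ) / (1 / 4)) +
        ENNReal.ofReal (8 * h / √(m + h)) * ENNReal.ofReal (2 * (5 * δ) / (1 / 2)) := by
        gcongr
        · exact (volume_abs_sub_le _ _).le
        · exact volume_sq_near_le_sqrt hh0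
    _ ≤ _ := by
        rw [← ENNReal.ofReal_mul (by positivity), ← ENNReal.ofReal_mul (by positivity),
          ← ENNReal.ofReal_add (by positivity) (by positivity)]
        exact ENNReal.ofReal_le_ofReal
          (inter_annuli_arith ha1 (Real.sqrt_pos.2 hmh) hsqrt hsq1 hsq2)

/-! ### Incidences between points and circles of equal radius -/

open Classical in
/-- The number of incidences of a relation between two finite sets. -/
noncomputable def incidences {α β : Type*} (G : Finset α) (H : Finset β) (rel : α → β → Prop) : ℝ :=
  ∑ x ∈ G, ((H.filter (rel x)).card : ℝ)

section incidences
variable {α β : Type*} {G : Finset α} {H : Finset β} {rel : α → β → Prop}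

theorem incidences_nonneg : 0 ≤ incidences G H rel :=
  Finset.sum_nonneg fun _ _ => Nat.cast_nonneg _

theorem incidences_eq_sum_ite [∀ x y, Decidable (rel x y)] :
    incidences G H rel = ∑ x ∈ G, ∑ y ∈ H, if rel x y then (1 : ℝ) else 0 := by
  unfold incidences
  refine Finset.sum_congr rfl fun x _ => ?_
  rw [Finset.sum_boole]
  congr!

theorem incidences_swap : incidences G H rel = incidences H G fun y x => rel x y := by
  classical
  rw [incidences_eq_sum_ite, incidences_eq_sum_ite, Finset.sum_comm]

theorem incidences_le_of_forall {a : ℝ}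
    (h : ∀ x ∈ G, ∀ P : Finset β, P ⊆ H → (∀ y ∈ P, rel x y) → (P.card : ℝ) ≤ a) :
    incidences G H rel ≤ G.card * a := by
  classical
  unfold incidences
  rw [← nsmul_eq_mul]
  exact Finset.sum_le_card_nsmul _ _ _ fun x hx =>
    h x hx _ (Finset.filter_subset _ _) fun y hy => (Finset.mem_filter.1 hy).2

theorem incidences_le_mul : incidences G H rel ≤ G.card * H.card :=
  incidences_le_of_forall fun _ _ _ hP _ => by exact_mod_cast Finset.card_le_card hP

/-- The Cauchy–Schwarz bound for incidences, with nearby pairs and distant pairs treated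
separately. -/
theorem sq_incidences_le (N : β → β → Prop) {a b : ℝ}
    (hnear : ∀ x ∈ G, ∀ y ∈ H, rel x y → ∀ P : Finset β, P ⊆ H →
      (∀ y' ∈ P, rel x y' ∧ N y y') → (P.card : ℝ) ≤ a)
    (hfar : ∀ y ∈ H, ∀ y' ∈ H, ¬N y y' → ∀ P : Finset α, P ⊆ G →
      (∀ x ∈ P, rel x y ∧ rel x y') → (P.card : ℝ) ≤ b) (hb : 0 ≤ b) :
    incidences G H rel ^ 2 ≤ G.card * (a * incidences G H rel + b * H.card ^ 2) := by
  classical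
  have h1 : incidences G H rel ^ 2 ≤ G.card * ∑ x ∈ G, ((H.filter (rel x)).card : ℝ) ^ 2 := by
    unfold incidences
    convert sq_sum_le_card_mul_sum_sq (s := G) (f := fun x => ((H.filter (rel x)).card : ℝ))
  refine h1.trans (mul_le_mul_of_nonneg_left ?_ (Nat.cast_nonneg _))
  have h2 : ∀ x ∈ G, ((H.filter (rel x)).card : ℝ) ^ 2 ≤
      a * (H.filter (rel x)).card +
        ∑ y ∈ H, ∑ y' ∈ H, if rel x y ∧ rel x y' ∧ ¬N y y' then (1 : ℝ) else 0 := by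
    intro x hx
    have h3 : ∀ y ∈ H.filter (rel x), ((H.filter (rel x)).card : ℝ) ≤
        a + ∑ y' ∈ H, if rel x y ∧ rel x y' ∧ ¬N y y' then (1 : ℝ) else 0 := by
      intro y hy
      rw [Finset.mem_filter] at hy
      have h4 := Finset.card_filter_add_card_filter_not (s := H.filter (rel x)) (N y)
      rw [← h4, Nat.cast_add]
      refine add_le_add (hnear x hx y hy.1 hy.2 _
        ((Finset.filter_subset _ _).trans (Finset.filter_subset _ _)) fun y' hy' => ?_) ?_
      · simp only [Finset.mem_filter] at hy'
        exact ⟨hy'.1.2, hy'.2⟩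
      · rw [Finset.sum_boole, Finset.filter_filter]
        norm_cast
        apply Finset.card_le_card
        intro y' hy'
        simp only [Finset.mem_filter] at hy' ⊢
        exact ⟨hy'.1, hy.2, hy'.2⟩
    have h5 := Finset.sum_le_sum h3
    rw [Finset.sum_const, nsmul_eq_mul, Finset.sum_add_distrib, Finset.sum_const, nsmul_eq_mul,
      mul_comm _ a, ← sq] at h5
    refine h5.trans (add_le_add le_rfl ?_)
    refine Finset.sum_le_sum_of_subset_of_nonneg (Finset.filter_subset _ _) fun y _ _ => ?_
    exact Finset.sum_nonneg fun _ _ => by split_ifs <;> norm_num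
  refine (Finset.sum_le_sum h2).trans ?_
  rw [Finset.sum_add_distrib, ← Finset.mul_sum]
  refine add_le_add (le_of_eq (by unfold incidences; congr!)) ?_
  rw [Finset.sum_comm]
  calc ∑ y ∈ H, ∑ x ∈ G, ∑ y' ∈ H, (if rel x y ∧ rel x y' ∧ ¬N y y' then (1 : ℝ) else 0)
      ≤ ∑ y ∈ H, ∑ y' ∈ H, b := by
        refine Finset.sum_le_sum fun y hy => ?_
        rw [Finset.sum_comm]
        refine Finset.sum_le_sum fun y' hy' => ?_
        by_cases hN : N y y'
        · simpa [hN] using hb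
        · rw [Finset.sum_boole]
          refine hfar y hy y' hy' hN _ (Finset.filter_subset _ _) fun x hx => ?_
          simp only [Finset.mem_filter] at hx
          exact ⟨hx.2.1, hx.2.2.1⟩
    _ = b * H.card ^ 2 := by
        simp only [Finset.sum_const, nsmul_eq_mul]
        ring

end incidences

/-! ### Incidence bounds for separated centres, quadrant by quadrant. -/

/-- The points of `P` have mutual distances at least `δ`. -/
def SeparatedPoints {ι : Type*} (δ : ℝ) (P : Finset ι) (f : ι → Plane) : Prop :=
  ∀ p ∈ P, ∀ q ∈ P, p ≠ q → δ ≤ dist (f p) (f q)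

theorem SeparatedPoints.mono {ι : Type*} {δ : ℝ} {P Q : Finset ι} {f : ι → Plane}
    (h : SeparatedPoints δ Q f) (hPQ : P ⊆ Q) : SeparatedPoints δ P f :=
  fun p hp q hq => h p (hPQ hp) q (hPQ hq)

/-- `y` lies near the circle of radius `R` about `x`, in the quadrant given by the signs `σ`, `τ`. -/
def QuadrantIncident (R ρ σ τ : ℝ) (x y : Plane) : Prop :=
  |dist x y - R| ≤ ρ ∧ 0 ≤ σ * (y 0 - x 0) ∧ 0 ≤ τ * (y 1 - x 1)

theorem QuadrantIncident.swap {R ρ σ τ : ℝ} {x y : Plane} :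
    QuadrantIncident R ρ σ τ x y ↔ QuadrantIncident R ρ (-σ) (-τ) y x := by
  unfold QuadrantIncident
  rw [dist_comm x y, show -σ * (x 0 - y 0) = σ * (y 0 - x 0) by ring,
    show -τ * (x 1 - y 1) = τ * (y 1 - x 1) by ring]

/-- Two vectors in the same quadrant have nonnegative inner product, so `|y - y'|² ≤ |y - x|² + |y'
- x|²`. This is what excludes nearly antipodal points, where the circles of radius `R` about `y` and
`y'` would be externally tangent. -/
theorem QuadrantIncident.dist_le {R ρ σ τ : ℝ} {x y y' : Plane} (hρ : 0 < ρ) (hR : 100 * ρ ≤ R)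
    (hσ : σ ^ 2 = 1) (hτ : τ ^ 2 = 1) (h : QuadrantIncident R ρ σ τ x y)
    (h' : QuadrantIncident R ρ σ τ x y') : dist y y' ≤ 3 / 2 * R := by
  obtain ⟨h1, h2, h3⟩ := h
  obtain ⟨h1', h2', h3'⟩ := h'
  have e1 := plane_dist_sq x y
  have e2 := plane_dist_sq x y'
  have e3 := plane_dist_sq y y'
  have k : ∀ D : ℝ, 0 ≤ D → |D - R| ≤ ρ → D ^ 2 ≤ (101 / 100 * R) ^ 2 := by
    intro D hD hDR
    apply pow_le_pow_left₀ hD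
    linarith [(abs_le.1 hDR).2]
  have k1 := k _ dist_nonneg h1
  have k2 := k _ dist_nonneg h1'
  have m1 : 0 ≤ (y 0 - x 0) * (y' 0 - x 0) := by
    have := mul_nonneg h2 h2'
    rwa [show σ * (y 0 - x 0) * (σ * (y' 0 - x 0)) =
      σ ^ 2 * ((y 0 - x 0) * (y' 0 - x 0)) by ring, hσ, one_mul] at this
  have m2 : 0 ≤ (y 1 - x 1) * (y' 1 - x 1) := by
    have := mul_nonneg h3 h3'
    rwa [show τ * (y 1 - x 1) * (τ * (y' 1 - x 1)) =
      τ ^ 2 * ((y 1 - x 1) * (y' 1 - x 1)) by ring, hτ, one_mul] at this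
  apply le_of_sq_le_sq _ (by linarith)
  nlinarith

/-- Cauchy–Schwarz with pairs in `H` split at distance `s`: a near class has `≲ ρs/δ²` members, and
a far pair has `≲ ρ²R/(sδ²)` common neighbours. The first alternative is the case where the optimal
`s` would fall below the thickness `ρ`. -/
theorem incidences_quadrant_dichotomy {ι κ : Type*} {G : Finset ι} {H : Finset κ}
    {f : ι → Plane} {g : κ → Plane} {δ ρ R σ τ : ℝ} (hδ : 0 < δ) (hδρ : δ ≤ ρ) (hR : 100 * ρ ≤ R)
    (hσ : σ ^ 2 = 1) (hτ : τ ^ 2 = 1) (hG : SeparatedPoints δ G f) (hH : SeparatedPoints δ H g) :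
    incidences G H (fun x y => QuadrantIncident R ρ σ τ (f x) (g y)) ≤
        1600 * (ρ ^ 2 / δ ^ 2) * G.card ∨
      incidences G H (fun x y => QuadrantIncident R ρ σ τ (f x) (g y)) ^ 3 ≤
        25600000 * (ρ ^ 3 * R / δ ^ 4) * (G.card ^ 2 * H.card ^ 2) := by
  have hρ : 0 < ρ := hδ.trans_le hδρ
  have hR0 : 0 < R := by linarith
  set I := incidences G H (fun x y => QuadrantIncident R ρ σ τ (f x) (g y)) with hI
  by_cases hIG : I ≤ 1600 * (ρ ^ 2 / δ ^ 2) * G.card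
  · exact Or.inl hIG
  right
  push Not at hIG
  have hI0 : 0 < I := lt_of_le_of_lt (by positivity) hIG
  have hG0 : (0 : ℝ) < G.card := by
    rcases (Nat.cast_nonneg (α := ℝ) G.card).eq_or_lt with h | h
    · have : I ≤ G.card * H.card := incidences_le_mul
      rw [← h, zero_mul] at this
      linarith
    · exact h
  -- This makes the near-pair contribution exactly `I² / 2`, which the left side absorbs.
  set s := I * δ ^ 2 / (1600 * ρ * G.card) with hs
  have hρs : ρ ≤ s := by
    rw [hs, le_div_iff₀ (by positivity)]
    have h1 : 1600 * (ρ ^ 2 / δ ^ 2) * G.card * δ ^ 2 ≤ I * δ ^ 2 := by gcongr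
    have h2 : 1600 * (ρ ^ 2 / δ ^ 2) * G.card * δ ^ 2 = ρ * (1600 * ρ * G.card) := by
      field_simp
    linarith
  have hs0 : 0 < s := by linarith
  have key := sq_incidences_le (G := G) (H := H)
    (rel := fun x y => QuadrantIncident R ρ σ τ (f x) (g y))
    (fun y y' => dist (g y') (g y) ≤ s)
    (a := 2 * (400 * (ρ * s)) / δ ^ 2) (b := 2 * (4000 * (ρ ^ 2 * R / s)) / δ ^ 2) ?_ ?_
    (by positivity)
  · rw [← hI] at key
    have e1 : 2 * (400 * (ρ * s)) / δ ^ 2 = I / (2 * G.card) := by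
      rw [hs]
      field_simp
      norm_num
    have e2 : 2 * (4000 * (ρ ^ 2 * R / s)) / δ ^ 2 =
        12800000 * (ρ ^ 3 * R / δ ^ 4) * (G.card / I) := by
      rw [hs]
      field_simp
      norm_num
    rw [e1, e2] at key
    have e3 : (G.card : ℝ) * (I / (2 * G.card) * I +
        12800000 * (ρ ^ 3 * R / δ ^ 4) * (G.card / I) * H.card ^ 2) =
        I ^ 2 / 2 + 12800000 * (ρ ^ 3 * R / δ ^ 4) * (G.card ^ 2 * H.card ^ 2) / I := by
      field_simp
    rw [e3] at key
    have e4 : I ^ 2 / 2 ≤ 12800000 * (ρ ^ 3 * R / δ ^ 4) * (G.card ^ 2 * H.card ^ 2) / I := by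
      linarith
    rw [le_div_iff₀ hI0] at e4
    nlinarith
  · intro x hx y hy hxy P hP hPr
    have hxy1 : |dist (g y) (f x) - R| ≤ ρ := by
      rw [dist_comm]
      exact hxy.1
    refine card_le_of_separated P g hδ (by positivity) (hH.mono hP) _ ?_
      (volume_annulus_inter_ball_le hρ hR hxy1 hρs)
    intro y' hy' z hz
    obtain ⟨⟨h1, -, -⟩, h2⟩ := hPr y' hy'
    rw [dist_comm] at h1
    have t1 := dist_triangle z (g y') (f x)
    have t2 := dist_triangle (g y') z (f x)
    have t3 := dist_triangle z (g y') (g y)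
    rw [dist_comm (g y') z] at t2
    rw [abs_le] at h1
    exact ⟨abs_le.2 ⟨by linarith, by linarith⟩, by linarith⟩
  · intro y hy y' hy' hN P hP hPr
    rcases P.eq_empty_or_nonempty with rfl | ⟨x₀, hx₀⟩
    · simp
      positivity
    rw [not_le, dist_comm] at hN
    have hd := (hPr x₀ hx₀).1.dist_le hρ hR hσ hτ (hPr x₀ hx₀).2
    have hle : 4000 * (ρ ^ 2 * R / dist (g y) (g y')) ≤ 4000 * (ρ ^ 2 * R / s) := by gcongr
    refine card_le_of_separated P f hδ (by positivity) (hG.mono hP) _ ?_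
      ((volume_inter_annuli_same_radius_le hρ hR (hs0.trans hN) hd).trans
        (ENNReal.ofReal_le_ofReal hle))
    intro x hx z hz
    obtain ⟨⟨h1, -, -⟩, ⟨h2, -, -⟩⟩ := hPr x hx
    rw [abs_le] at h1 h2
    have t1 := dist_triangle z (f x) (g y)
    have t2 := dist_triangle (f x) z (g y)
    have t3 := dist_triangle z (f x) (g y')
    have t4 := dist_triangle (f x) z (g y')
    rw [dist_comm (f x) z] at t2 t4
    exact ⟨abs_le.2 ⟨by linarith, by linarith⟩, abs_le.2 ⟨by linarith, by linarith⟩⟩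

/-- The first alternative is harmless when the set summed over is the smaller one: either `ρ³g/δ² ≤
Rh²` and cubing suffices, or `g ≤ h` forces `Rh ≤ ρ³/δ²`, so that `h² ≤ ρ³R/δ⁴` and the trivial
bound `I ≤ gh` suffices. -/
theorem incidences_quadrant_aux {g h I ρ δ R : ℝ} (hδ : 0 < δ) (hδρ : δ ≤ ρ) (hR : 100 * ρ ≤ R)
    (hg : 0 ≤ g) (hgh : g ≤ h) (hI : 0 ≤ I) (hIgh : I ≤ g * h)
    (hd : I ≤ 1600 * (ρ ^ 2 / δ ^ 2) * g ∨
      I ^ 3 ≤ 25600000 * (ρ ^ 3 * R / δ ^ 4) * (g ^ 2 * h ^ 2)) :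
    I ^ 3 ≤ 4096000000 * (ρ ^ 3 * R / δ ^ 4) * (g * h) ^ 2 := by
  have hρ : 0 < ρ := hδ.trans_le hδρ
  have hR0 : 0 < R := by linarith
  have hh : 0 ≤ h := hg.trans hgh
  rcases hd with hd | hd
  · rcases le_or_gt (ρ ^ 3 / δ ^ 2 * g) (R * h ^ 2) with hc | hc
    · calc I ^ 3 ≤ (1600 * (ρ ^ 2 / δ ^ 2) * g) ^ 3 := by gcongr
        _ = 4096000000 * (ρ ^ 3 / δ ^ 4) * g ^ 2 * (ρ ^ 3 / δ ^ 2 * g) := by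
          field_simp
          ring
        _ ≤ 4096000000 * (ρ ^ 3 / δ ^ 4) * g ^ 2 * (R * h ^ 2) := by gcongr
        _ = _ := by ring
    · have hh0 : 0 < h := by
        rcases hh.eq_or_lt with h0 | h0
        · have : g = 0 := by linarith
          rw [this, ← h0] at hc
          simp at hc
        · exact h0
      have h1 : R * h ≤ ρ ^ 3 / δ ^ 2 := by
        have : R * h ^ 2 ≤ ρ ^ 3 / δ ^ 2 * h :=
          hc.le.trans (mul_le_mul_of_nonneg_left hgh (by positivity))
        nlinarith
      have h2 : (R * h) ^ 2 ≤ (ρ ^ 3 / δ ^ 2) ^ 2 := pow_le_pow_left₀ (by positivity) h1 2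
      have h3 : h ^ 2 ≤ ρ ^ 3 * R / δ ^ 4 := by
        have h4 : (ρ ^ 3 / δ ^ 2) ^ 2 ≤ R ^ 2 * (ρ ^ 3 * R / δ ^ 4) := by
          rw [show (ρ ^ 3 / δ ^ 2) ^ 2 = ρ ^ 3 * ρ ^ 3 / δ ^ 4 by field_simp,
            show R ^ 2 * (ρ ^ 3 * R / δ ^ 4) = ρ ^ 3 * R ^ 3 / δ ^ 4 by ring]
          gcongr
          linarith
        have h5 : 0 < R ^ 2 := by positivity
        nlinarith
      calc I ^ 3 ≤ (g * h) ^ 3 := by gcongr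
        _ = (g * h) * (g * h) ^ 2 := by ring
        _ ≤ (h * h) * (g * h) ^ 2 := by gcongr
        _ = h ^ 2 * (g * h) ^ 2 := by ring
        _ ≤ (ρ ^ 3 * R / δ ^ 4) * (g * h) ^ 2 := by gcongr
        _ ≤ _ := by
          have : 0 ≤ (ρ ^ 3 * R / δ ^ 4) * (g * h) ^ 2 := by positivity
          linarith
  · have : 0 ≤ (ρ ^ 3 * R / δ ^ 4) * (g ^ 2 * h ^ 2) := by positivity
    rw [mul_pow]
    linarith

theorem incidences_quadrant_cube_le {ι κ : Type*} {G : Finset ι} {H : Finset κ}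
    {f : ι → Plane} {g : κ → Plane} {δ ρ R σ τ : ℝ} (hδ : 0 < δ) (hδρ : δ ≤ ρ) (hR : 100 * ρ ≤ R)
    (hσ : σ ^ 2 = 1) (hτ : τ ^ 2 = 1) (hG : SeparatedPoints δ G f) (hH : SeparatedPoints δ H g) :
    incidences G H (fun x y => QuadrantIncident R ρ σ τ (f x) (g y)) ^ 3 ≤
        4096000000 * (ρ ^ 3 * R / δ ^ 4) * (G.card * H.card) ^ 2 := by
  rcases le_total (G.card : ℝ) H.card with h | h
  · exact incidences_quadrant_aux hδ hδρ hR (Nat.cast_nonneg _) h incidences_nonneg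
      incidences_le_mul (incidences_quadrant_dichotomy hδ hδρ hR hσ hτ hG hH)
  · rw [incidences_swap, mul_comm (G.card : ℝ)]
    refine incidences_quadrant_aux hδ hδρ hR (Nat.cast_nonneg _) h incidences_nonneg
      incidences_le_mul ?_
    simp only [QuadrantIncident.swap (σ := σ)]
    exact incidences_quadrant_dichotomy hδ hδρ hR (by rwa [neg_sq]) (by rwa [neg_sq]) hH hG

theorem incidences_le_four_mul {ι κ : Type*} (G : Finset ι) (H : Finset κ)
    (f : ι → Plane) (g : κ → Plane) (ρ R : ℝ) :
    ∃ σ τ : ℝ, σ ^ 2 = 1 ∧ τ ^ 2 = 1 ∧ incidences G H (fun x y => |dist (f x) (g y) - R| ≤ ρ) ≤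
      4 * incidences G H (fun x y => QuadrantIncident R ρ σ τ (f x) (g y)) := by
  classical
  by_contra! hcon
  have h1 := hcon 1 1 (by norm_num) (by norm_num)
  have h2 := hcon 1 (-1) (by norm_num) (by norm_num)
  have h3 := hcon (-1) 1 (by norm_num) (by norm_num)
  have h4 := hcon (-1) (-1) (by norm_num) (by norm_num)
  have h5 : incidences G H (fun x y => |dist (f x) (g y) - R| ≤ ρ) ≤
      incidences G H (fun x y => QuadrantIncident R ρ 1 1 (f x) (g y)) +
      incidences G H (fun x y => QuadrantIncident R ρ 1 (-1) (f x) (g y)) +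
      incidences G H (fun x y => QuadrantIncident R ρ (-1) 1 (f x) (g y)) +
      incidences G H (fun x y => QuadrantIncident R ρ (-1) (-1) (f x) (g y)) := by
    simp only [incidences_eq_sum_ite, ← Finset.sum_add_distrib]
    refine Finset.sum_le_sum fun x _ => Finset.sum_le_sum fun y _ => ?_
    have nn : ∀ (p : Prop) [Decidable p], (0 : ℝ) ≤ if p then 1 else 0 := by
      intro p _
      split_ifs <;> norm_num
    have n1 := nn (QuadrantIncident R ρ 1 1 (f x) (g y))
    have n2 := nn (QuadrantIncident R ρ 1 (-1) (f x) (g y))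
    have n3 := nn (QuadrantIncident R ρ (-1) 1 (f x) (g y))
    have n4 := nn (QuadrantIncident R ρ (-1) (-1) (f x) (g y))
    by_cases hxy : |dist (f x) (g y) - R| ≤ ρ
    · rw [if_pos hxy]
      rcases le_total 0 (g y 0 - f x 0) with hu | hu <;>
        rcases le_total 0 (g y 1 - f x 1) with hv | hv
      · rw [if_pos (show QuadrantIncident R ρ 1 1 (f x) (g y) from
          ⟨hxy, by linarith, by linarith⟩)]
        linarith
      · rw [if_pos (show QuadrantIncident R ρ 1 (-1) (f x) (g y) from
          ⟨hxy, by linarith, by linarith⟩)]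
        linarith
      · rw [if_pos (show QuadrantIncident R ρ (-1) 1 (f x) (g y) from
          ⟨hxy, by linarith, by linarith⟩)]
        linarith
      · rw [if_pos (show QuadrantIncident R ρ (-1) (-1) (f x) (g y) from
          ⟨hxy, by linarith, by linarith⟩)]
        linarith
    · rw [if_neg hxy]
      linarith
  linarith

theorem card_le_of_near_circle {ι : Type*} {P : Finset ι} {k : ι → Plane} {x : Plane} {δ ρ R : ℝ}
    (hδ : 0 < δ) (hδρ : δ ≤ ρ) (hR : R < 100 * ρ) (hP : SeparatedPoints δ P k)
    (hPr : ∀ y ∈ P, |dist x (k y) - R| ≤ ρ) :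
    (P.card : ℝ) ≤ 100000 * (ρ ^ 2 / δ ^ 2) := by
  have hρ : 0 < ρ := hδ.trans_le hδρ
  have := card_le_of_separated P k hδ (V := 4 * (102 * ρ) ^ 2) (by positivity) hP
    (Metric.ball x (102 * ρ)) ?_ ?_
  · refine this.trans ?_
    rw [mul_div_assoc', div_le_div_iff_of_pos_right (by positivity)]
    nlinarith [sq_nonneg ρ]
  · intro y hy z hz
    rw [Metric.mem_ball]
    have h1 := (abs_le.1 (hPr y hy)).2
    have h2 := dist_triangle z (k y) x
    rw [dist_comm (k y) x] at h2
    linarith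
  · rw [EuclideanSpace.volume_ball_fin_two, ← ENNReal.ofReal_pow (by positivity),
      ← ENNReal.ofReal_mul (by positivity)]
    apply ENNReal.ofReal_le_ofReal
    rw [mul_comm]
    gcongr
    exact Real.pi_le_four

/-- A restricted `L^{6/5} → L^6` estimate for averages over circles of radius `R` at scale `ρ`. -/
theorem incidences_pow_six_le {ι κ : Type*} {G : Finset ι} {H : Finset κ}
    {f : ι → Plane} {g : κ → Plane} {δ ρ R : ℝ} (hδ : 0 < δ) (hδρ : δ ≤ ρ) (hR : 0 ≤ R)
    (hG : SeparatedPoints δ G f) (hH : SeparatedPoints δ H g) :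
    incidences G H (fun x y => |dist (f x) (g y) - R| ≤ ρ) ^ 6 ≤
      1000000 ^ 2 * (ρ ^ 3 * (R + ρ) / δ ^ 4) * (G.card * H.card) ^ 5 := by
  have hρ : 0 < ρ := hδ.trans_le hδρ
  set I := incidences G H (fun x y => |dist (f x) (g y) - R| ≤ ρ) with hI
  have hI0 : 0 ≤ I := incidences_nonneg
  have hIm : I ≤ G.card * H.card := incidences_le_mul
  rcases le_or_gt (100 * ρ) R with h | h
  · obtain ⟨σ, τ, hσ, hτ, h4⟩ := incidences_le_four_mul G H f g ρ R
    rw [← hI] at h4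
    have h5 := incidences_quadrant_cube_le hδ hδρ h hσ hτ hG hH
    have h6 : I ^ 3 ≤ 64 * (4096000000 * (ρ ^ 3 * R / δ ^ 4) * (G.card * H.card) ^ 2) := by
      calc I ^ 3 ≤ (4 * incidences G H fun x y => QuadrantIncident R ρ σ τ (f x) (g y)) ^ 3 := by
            gcongr
        _ = 64 * (incidences G H fun x y => QuadrantIncident R ρ σ τ (f x) (g y)) ^ 3 := by ring
        _ ≤ _ := by gcongr
    have h7 : ρ ^ 3 * R / δ ^ 4 ≤ ρ ^ 3 * (R + ρ) / δ ^ 4 := by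
      gcongr
      linarith
    -- The cubic bound is used for one factor and the trivial bound for the other.
    calc I ^ 6 = I ^ 3 * I ^ 3 := by ring
      _ ≤ (64 * (4096000000 * (ρ ^ 3 * R / δ ^ 4) * (G.card * H.card) ^ 2)) *
          (G.card * H.card) ^ 3 := by gcongr
      _ = 64 * 4096000000 * (ρ ^ 3 * R / δ ^ 4) * (G.card * H.card) ^ 5 := by ring
      _ ≤ 1000000 ^ 2 * (ρ ^ 3 * (R + ρ) / δ ^ 4) * (G.card * H.card) ^ 5 := by
        gcongr
        norm_num
  · have c1 : I ≤ G.card * (100000 * (ρ ^ 2 / δ ^ 2)) :=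
      incidences_le_of_forall fun x _ P hP hPr => card_le_of_near_circle hδ hδρ h (hH.mono hP) hPr
    have c2 : I ≤ H.card * (100000 * (ρ ^ 2 / δ ^ 2)) := by
      rw [hI, incidences_swap]
      refine incidences_le_of_forall fun y _ P hP hPr => card_le_of_near_circle
        (x := g y) hδ hδρ h (hG.mono hP) ?_
      intro x hx
      rw [dist_comm]
      exact hPr x hx
    have h7 : ρ ^ 3 * ρ / δ ^ 4 ≤ ρ ^ 3 * (R + ρ) / δ ^ 4 := by
      gcongr
      linarith
    calc I ^ 6 = I * I * I ^ 4 := by ring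
      _ ≤ (G.card * (100000 * (ρ ^ 2 / δ ^ 2))) * (H.card * (100000 * (ρ ^ 2 / δ ^ 2))) *
          (G.card * H.card) ^ 4 := by gcongr
      _ = 100000 ^ 2 * (ρ ^ 3 * ρ / δ ^ 4) * (G.card * H.card) ^ 5 := by
        field_simp
      _ ≤ 1000000 ^ 2 * (ρ ^ 3 * (R + ρ) / δ ^ 4) * (G.card * H.card) ^ 5 := by
        gcongr
        norm_num

/-! ### The `L²` estimate for the multiplicity function -/

theorem mul_mul_le_mean_pow_six {X Y Z : ℝ} (hX : 0 ≤ X) (hY : 0 ≤ Y) (hZ : 0 ≤ Z) :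
    X ^ 4 * Y * Z ≤ ((4 * X + Y + Z) / 6) ^ 6 := by
  have h := Real.geom_mean_le_arith_mean3_weighted (w₁ := 4 / 6) (w₂ := 1 / 6) (w₃ := 1 / 6)
    (by norm_num) (by norm_num) (by norm_num) hX hY hZ (by norm_num)
  have h6 := pow_le_pow_left₀ (by positivity) h 6
  have e : (X ^ (4 / 6 : ℝ) * Y ^ (1 / 6 : ℝ) * Z ^ (1 / 6 : ℝ)) ^ 6 = X ^ 4 * Y * Z := by
    rw [mul_pow, mul_pow, ← Real.rpow_natCast, ← Real.rpow_natCast, ← Real.rpow_natCast,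
      ← Real.rpow_mul hX, ← Real.rpow_mul hY, ← Real.rpow_mul hZ]
    norm_num
  rw [e] at h6
  rwa [show 4 / 6 * X + 1 / 6 * Y + 1 / 6 * Z = (4 * X + Y + Z) / 6 by ring] at h6

/-- A bilinear Young inequality at the exponents `6/5, 6/5, 3`. -/
theorem sum_sum_le_of_pow_six_le {S : Finset ℕ} {a : ℕ → ℝ} {κ w : ℕ → ℕ → ℝ} {L M : ℝ}
    (ha : ∀ j, 0 ≤ a j) (hκ : ∀ j k, 0 < κ j k) (hsymm : ∀ j k, κ j k = κ k j)
    (hL : 0 < L) (hκL : ∀ j ∈ S, ∑ k ∈ S, (κ j k)⁻¹ ≤ L)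
    (hM : 0 ≤ M) (hM3 : M ^ 3 = L * (∑ j ∈ S, a j) ^ 5)
    (hw : ∀ j ∈ S, ∀ k ∈ S, w j k ^ 6 ≤ (a j * a k) ^ 5 / κ j k ^ 2) :
    ∑ j ∈ S, ∑ k ∈ S, w j k ≤ M := by
  set A := ∑ j ∈ S, a j with hA
  have hA0 : 0 ≤ A := Finset.sum_nonneg fun j _ => ha j
  rcases hA0.eq_or_lt with hA0 | hA0
  · have haj : ∀ j ∈ S, a j = 0 := (Finset.sum_eq_zero_iff_of_nonneg fun j _ => ha j).1 hA0.symm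
    refine le_trans (Finset.sum_nonpos fun j hj => Finset.sum_nonpos fun k hk => ?_) hM
    have := hw j hj k hk
    rw [haj j hj] at this
    norm_num at this
    by_contra hc
    push Not at hc
    have := pow_pos hc 6
    linarith
  have hM0 : 0 < M := by
    rcases hM.eq_or_lt with h | h
    · have h0 : M ^ 3 = 0 := by
        rw [← h]
        norm_num
      have : 0 < L * A ^ 5 := by positivity
      linarith
    · exact h
  -- The sixth-power bound on `w j k` equals `M⁶X⁴YZ`, where each of `X`, `Y`, `Z` has total at most
  -- `1` over all pairs; weighted AM–GM makes the sum linear in them.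
  have key : ∀ j ∈ S, ∀ k ∈ S, w j k ≤
      M / 6 * (4 * (a j * a k / A ^ 2) + a j * (κ j k)⁻¹ / (L * A) + a k * (κ j k)⁻¹ / (L * A)) := by
    intro j hj k hk
    have hj0 := ha j
    have hk0 := ha k
    have hκ0 := hκ j k
    have h1 := mul_mul_le_mean_pow_six (X := a j * a k / A ^ 2) (Y := a j * (κ j k)⁻¹ / (L * A))
      (Z := a k * (κ j k)⁻¹ / (L * A)) (by positivity) (by positivity) (by positivity)
    have h2 : (a j * a k) ^ 5 / κ j k ^ 2 = M ^ 6 * ((a j * a k / A ^ 2) ^ 4 *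
        (a j * (κ j k)⁻¹ / (L * A)) * (a k * (κ j k)⁻¹ / (L * A))) := by
      rw [show M ^ 6 = (M ^ 3) ^ 2 by ring, hM3]
      field_simp
    refine le_of_pow_le_pow_left₀ (n := 6) (by norm_num) (by positivity) ?_
    refine (hw j hj k hk).trans ?_
    rw [div_mul_eq_mul_div M, mul_div_assoc M, mul_pow M, h2]
    gcongr
  refine (Finset.sum_le_sum fun j hj => Finset.sum_le_sum fun k hk => key j hj k hk).trans ?_
  have e1 : ∑ j ∈ S, ∑ k ∈ S, a j * a k = A ^ 2 := by
    rw [sq, hA, Finset.sum_mul_sum]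
  have e2 : ∑ j ∈ S, ∑ k ∈ S, a j * (κ j k)⁻¹ ≤ L * A := by
    rw [hA, Finset.mul_sum]
    refine Finset.sum_le_sum fun j hj => ?_
    rw [← Finset.mul_sum, mul_comm]
    exact mul_le_mul_of_nonneg_right (hκL j hj) (ha j)
  have e3 : ∑ j ∈ S, ∑ k ∈ S, a k * (κ j k)⁻¹ ≤ L * A := by
    rw [Finset.sum_comm]
    simpa only [hsymm] using e2
  have e4 := div_le_one_of_le₀ e2 (by positivity)
  have e5 := div_le_one_of_le₀ e3 (by positivity)
  calc ∑ j ∈ S, ∑ k ∈ S, M / 6 *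
        (4 * (a j * a k / A ^ 2) + a j * (κ j k)⁻¹ / (L * A) + a k * (κ j k)⁻¹ / (L * A))
      = M / 6 * (4 * ((∑ j ∈ S, ∑ k ∈ S, a j * a k) / A ^ 2) +
          (∑ j ∈ S, ∑ k ∈ S, a j * (κ j k)⁻¹) / (L * A) +
          (∑ j ∈ S, ∑ k ∈ S, a k * (κ j k)⁻¹) / (L * A)) := by
        simp only [Finset.mul_sum, Finset.sum_add_distrib, Finset.sum_div, mul_add]
    _ ≤ M := by
        rw [e1, div_self (by positivity)]
        nlinarith

theorem sum_inv_one_add_abs_sub_le {N j : ℕ} (hj : j < N) :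
    ∑ k ∈ Finset.range N, (1 + |(j : ℝ) - k|)⁻¹ ≤ 2 * (1 + Real.log N) := by
  have h1 : ∀ k ∈ Finset.range N, (1 + |(j : ℝ) - k|)⁻¹ ≤
      ∑ m ∈ Finset.range N, ((if k + m = j then ((m : ℝ) + 1)⁻¹ else 0) +
        if k = j + m then ((m : ℝ) + 1)⁻¹ else 0) := by
    intro k hk
    rw [Finset.mem_range] at hk
    have nn : ∀ m ∈ Finset.range N, 0 ≤ ((if k + m = j then ((m : ℝ) + 1)⁻¹ else 0) +
        if k = j + m then ((m : ℝ) + 1)⁻¹ else 0) := by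
      intro m _
      split_ifs <;> positivity
    rcases le_total k j with hkj | hkj
    · refine le_trans ?_ (Finset.single_le_sum nn (Finset.mem_range.2 (by omega : j - k < N)))
      rw [if_pos (by omega)]
      have : |(j : ℝ) - k| = ((j - k : ℕ) : ℝ) := by
        rw [Nat.cast_sub hkj, abs_of_nonneg]
        simpa using hkj
      rw [this, add_comm 1]
      have : 0 ≤ if k = j + (j - k) then (((j - k : ℕ) : ℝ) + 1)⁻¹ else 0 := by
        split_ifs <;> positivity
      linarith
    · refine le_trans ?_ (Finset.single_le_sum nn (Finset.mem_range.2 (by omega : k - j < N)))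
      rw [if_pos (show k = j + (k - j) by omega)]
      have : |(j : ℝ) - k| = ((k - j : ℕ) : ℝ) := by
        rw [Nat.cast_sub hkj, abs_sub_comm, abs_of_nonneg]
        simpa using hkj
      rw [this, add_comm 1]
      have : 0 ≤ if k + (k - j) = j then (((k - j : ℕ) : ℝ) + 1)⁻¹ else 0 := by
        split_ifs <;> positivity
      linarith
  refine (Finset.sum_le_sum h1).trans ?_
  rw [Finset.sum_comm]
  have h2 : ∀ m ∈ Finset.range N, ∑ k ∈ Finset.range N,
      ((if k + m = j then ((m : ℝ) + 1)⁻¹ else 0) + if k = j + m then ((m : ℝ) + 1)⁻¹ else 0) ≤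
      2 * ((m : ℝ) + 1)⁻¹ := by
    intro m _
    rw [Finset.sum_add_distrib, two_mul]
    have hm : 0 ≤ ((m : ℝ) + 1)⁻¹ := by positivity
    refine add_le_add ?_ ?_
    · calc ∑ k ∈ Finset.range N, (if k + m = j then ((m : ℝ) + 1)⁻¹ else 0)
          ≤ ∑ k ∈ Finset.range N, (if k = j - m then ((m : ℝ) + 1)⁻¹ else 0) := by
            refine Finset.sum_le_sum fun k _ => ?_
            split_ifs <;> first | omega | linarith
        _ ≤ ((m : ℝ) + 1)⁻¹ := by
            rw [Finset.sum_ite_eq']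
            split_ifs <;> linarith
    · rw [Finset.sum_ite_eq']
      split_ifs <;> linarith
  refine (Finset.sum_le_sum h2).trans ?_
  rw [← Finset.mul_sum]
  refine mul_le_mul_of_nonneg_left ?_ (by norm_num)
  have := harmonic_le_one_add_log N
  simpa [harmonic] using this

theorem abs_dist_sub_le_of_mem_annulus {δ : ℝ} {C : PlaneCircle} {y : Plane} (hy : y ∈ annulus δ C) :
    |dist y C.center - C.radius| ≤ δ := by
  obtain ⟨z, hz, hyz⟩ := Metric.mem_thickening_iff.1 hy
  have hz' : dist z C.center = C.radius := hz
  rw [← hz']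
  exact (abs_dist_sub_le y z C.center).trans hyz.le

/-- The area of the intersection of two annuli. -/
noncomputable def interArea (δ : ℝ) (C C' : PlaneCircle) : ℝ :=
  volume.real (annulus δ C ∩ annulus δ C')

theorem interArea_nonneg (δ : ℝ) (C C' : PlaneCircle) : 0 ≤ interArea δ C C' :=
  measureReal_nonneg

theorem interArea_le {δ : ℝ} (hδ : 0 < δ) (hδ1 : δ < 1) {C C' : PlaneCircle}
    (hC : C.radius ∈ Set.Icc (1 : ℝ) 2) (hC' : C'.radius ∈ Set.Icc (1 : ℝ) 2)
    (hd : dist C.center C'.center ≤ 3 / 2) :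
    interArea δ C C' ≤ 20000 * (δ ^ 2 /
      √((δ + |dist C.center C'.center - abs (C.radius - C'.radius)|) *
        (δ + dist C.center C'.center + |C.radius - C'.radius|))) := by
  refine ENNReal.toReal_le_of_le_ofReal (by positivity) ?_
  refine le_trans (measure_mono ?_) (volume_inter_annuli_le hδ hδ1 hC hC' hd)
  exact fun y hy => ⟨abs_dist_sub_le_of_mem_annulus hy.1, abs_dist_sub_le_of_mem_annulus hy.2⟩

/-! ### Dyadic scales of tangency and slices by radius. -/

/-- The number of dyadic scales between `δ` and `1`. -/
noncomputable def scaleCount (δ : ℝ) : ℕ := Nat.log 2 ⌊4 / δ⌋₊ + 1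

open Classical in
/-- Dyadic decomposition according to the degree of tangency. -/
theorem interArea_le_sum_scales {δ : ℝ} (hδ : 0 < δ) (hδ1 : δ < 1) {C C' : PlaneCircle}
    (hC : C.radius ∈ Set.Icc (1 : ℝ) 2) (hC' : C'.radius ∈ Set.Icc (1 : ℝ) 2)
    (hd : dist C.center C'.center ≤ 3 / 2) {R : ℝ} (hR : 0 ≤ R)
    (hCR : |abs (C.radius - C'.radius) - R| ≤ δ / 2) :
    interArea δ C C' ≤ ∑ i ∈ Finset.range (scaleCount δ),
      60000 * δ ^ 2 / √((2 ^ (i + 1) * δ) * (R + 2 ^ (i + 1) * δ)) *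
        if |dist C.center C'.center - R| ≤ 2 ^ (i + 1) * δ then 1 else 0 := by
  have hle := interArea_le hδ hδ1 hC hC' hd
  set a := dist C.center C'.center with ha
  set b := |C.radius - C'.radius| with hb
  have ha0 : 0 ≤ a := dist_nonneg
  have hb0 : 0 ≤ b := abs_nonneg _
  have hb1 : b ≤ 1 := abs_le.2 ⟨by linarith [hC.1, hC'.2], by linarith [hC.2, hC'.1]⟩
  have hΔ0 := abs_nonneg (a - b)
  have hΔ1 : |a - b| ≤ 3 / 2 := abs_le.2 ⟨by linarith, by linarith⟩
  have hΔ2 : |a - b| ≤ a + b := abs_le.2 ⟨by linarith, by linarith⟩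
  -- The scale with `2^i δ ≤ δ + |a - b| < 2^(i+1) δ`; replacing `b` by `R` costs only `δ/2`, so the
  -- indicator equals `1` at this scale.
  obtain ⟨i, hi1, hi2⟩ := exists_nat_pow_near (x := (δ + |a - b|) / δ) (y := 2)
    (by rw [le_div_iff₀ hδ]; linarith) (by norm_num)
  rw [le_div_iff₀ hδ] at hi1
  rw [div_lt_iff₀ hδ] at hi2
  have hin : i ∈ Finset.range (scaleCount δ) := by
    rw [Finset.mem_range, scaleCount, Nat.lt_succ_iff]
    apply Nat.le_log_of_pow_le (by norm_num)
    apply Nat.le_floor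
    push_cast
    rw [le_div_iff₀ hδ]
    linarith
  refine le_trans ?_ (Finset.single_le_sum (fun i _ => ?_) hin)
  · have hnear : |a - R| ≤ 2 ^ (i + 1) * δ := by
      have := abs_sub_le a b R
      linarith
    rw [if_pos hnear, mul_one]
    refine hle.trans ?_
    have hp : 0 < 2 ^ (i + 1) * δ := by positivity
    have hp2 : (2 : ℝ) ^ (i + 1) * δ = 2 * (2 ^ i * δ) := by ring
    set p := (2 : ℝ) ^ (i + 1) * δ
    have h1 : √(p * (R + p)) ≤ 3 * √((δ + |a - b|) * (δ + a + b)) := by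
      rw [Real.sqrt_le_left (by positivity), mul_pow, Real.sq_sqrt (by positivity)]
      have h2 : R + p ≤ 3 * (δ + a + b) := by
        have := (abs_le.1 hCR).1
        linarith
      have h3 : p * (R + p) ≤ (2 * (δ + |a - b|)) * (3 * (δ + a + b)) := by
        apply mul_le_mul _ h2 (by positivity) (by positivity)
        linarith
      have : 0 ≤ (δ + |a - b|) * (δ + a + b) := by positivity
      linarith
    have h4 : 0 < √((δ + |a - b|) * (δ + a + b)) := Real.sqrt_pos.2 (by positivity)
    have h5 : 0 < √(p * (R + p)) := Real.sqrt_pos.2 (by positivity)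
    rw [mul_div_assoc', div_le_div_iff₀ h4 h5]
    nlinarith [sq_nonneg δ]
  · split_ifs
    · positivity
    · simp

/-- A finite family of circles with radii in `[1,2]`, centres in a bounded region, and mutual
distances greater than `δ`. -/
structure IsLocalCircleFamily (δ : ℝ) (𝒜 : Finset PlaneCircle) : Prop where
  radius_mem : ∀ C ∈ 𝒜, C.radius ∈ Set.Icc (1 : ℝ) 2
  dist_le : ∀ C ∈ 𝒜, ∀ C' ∈ 𝒜, dist C.center C'.center ≤ 3 / 2
  separated : ∀ C ∈ 𝒜, ∀ C' ∈ 𝒜, C ≠ C' → δ < circleDist C C'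

/-- The slot of the radius of a circle at scale `δ / 2`. -/
noncomputable def radiusSlot (δ : ℝ) (C : PlaneCircle) : ℕ := ⌊2 * C.radius / δ⌋₊

theorem radiusSlot_bounds {δ : ℝ} (hδ : 0 < δ) {C : PlaneCircle} (hC : 0 ≤ C.radius) :
    radiusSlot δ C * (δ / 2) ≤ C.radius ∧ C.radius < (radiusSlot δ C + 1) * (δ / 2) := by
  have h1 := Nat.floor_le (show 0 ≤ 2 * C.radius / δ by positivity)
  have h2 := Nat.lt_floor_add_one (2 * C.radius / δ)
  rw [le_div_iff₀ hδ] at h1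
  rw [div_lt_iff₀ hδ] at h2
  unfold radiusSlot
  constructor <;> linarith

/-- The members of a family with a given radius slot. -/
noncomputable def radiusSlice (δ : ℝ) (𝒜 : Finset PlaneCircle) (j : ℕ) : Finset PlaneCircle :=
  𝒜.filter fun C => radiusSlot δ C = j

theorem sum_eq_sum_radiusSlice {δ : ℝ} {𝒜 : Finset PlaneCircle} {N : ℕ}
    (h : ∀ C ∈ 𝒜, radiusSlot δ C ∈ Finset.range N) (F : PlaneCircle → ℝ) :
    ∑ C ∈ 𝒜, F C = ∑ j ∈ Finset.range N, ∑ C ∈ radiusSlice δ 𝒜 j, F C :=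
  (Finset.sum_fiberwise_of_maps_to h F).symm

/-- Slots of width `δ/2` let the radii use at most half of the separation `δ`, leaving `δ/2` for the
centres. -/
theorem IsLocalCircleFamily.separatedPoints_radiusSlice {δ : ℝ} (hδ : 0 < δ)
    {𝒜 : Finset PlaneCircle} (h : IsLocalCircleFamily δ 𝒜) (j : ℕ) :
    SeparatedPoints (δ / 2) (radiusSlice δ 𝒜 j) EuclideanGeometry.Sphere.center := by
  intro C hC C' hC' hne
  unfold radiusSlice at hC hC'
  rw [Finset.mem_filter] at hC hC'
  have h1 := h.separated C hC.1 C' hC'.1 hne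
  have h2 := radiusSlot_bounds hδ (zero_le_one.trans (h.radius_mem C hC.1).1)
  have h3 := radiusSlot_bounds hδ (zero_le_one.trans (h.radius_mem C' hC'.1).1)
  rw [hC.2] at h2
  rw [hC'.2] at h3
  have h4 : |C.radius - C'.radius| ≤ δ / 2 := abs_le.2 ⟨by linarith, by linarith⟩
  unfold circleDist at h1
  linarith

/-- The interaction of two slices of a family of circles. -/
theorem IsLocalCircleFamily.sum_radiusSlice_le {δ : ℝ} (hδ : 0 < δ) (hδ1 : δ < 1)
    {𝒜 : Finset PlaneCircle} (h : IsLocalCircleFamily δ 𝒜) (j k : ℕ) {w : ℝ} (hw0 : 0 ≤ w)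
    (hw : w ^ 6 = (((radiusSlice δ 𝒜 j).card : ℝ) * (radiusSlice δ 𝒜 k).card) ^ 5 /
      (1 + |(j : ℝ) - k|) ^ 2) :
    ∑ C ∈ radiusSlice δ 𝒜 j, ∑ C' ∈ radiusSlice δ 𝒜 k, interArea δ C C' ≤
      12000000 * scaleCount δ * δ * w := by
  classical
  set R := |(j : ℝ) - k| * (δ / 2) with hR
  have hR0 : 0 ≤ R := by positivity
  set G := radiusSlice δ 𝒜 j with hG
  set H := radiusSlice δ 𝒜 k with hH
  have hmem : ∀ {l : ℕ}, ∀ C ∈ radiusSlice δ 𝒜 l, C ∈ 𝒜 ∧ radiusSlot δ C = l :=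
    fun C hC => Finset.mem_filter.1 hC
  calc ∑ C ∈ G, ∑ C' ∈ H, interArea δ C C'
      ≤ ∑ C ∈ G, ∑ C' ∈ H, ∑ i ∈ Finset.range (scaleCount δ),
        60000 * δ ^ 2 / √((2 ^ (i + 1) * δ) * (R + 2 ^ (i + 1) * δ)) *
        if |dist C.center C'.center - R| ≤ 2 ^ (i + 1) * δ then 1 else 0 := by
        refine Finset.sum_le_sum fun C hC => Finset.sum_le_sum fun C' hC' => ?_
        obtain ⟨hCA, hCj⟩ := hmem C hC
        obtain ⟨hCA', hCk⟩ := hmem C' hC'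
        refine interArea_le_sum_scales hδ hδ1 (h.radius_mem C hCA) (h.radius_mem C' hCA')
          (h.dist_le C hCA C' hCA') hR0 ?_
        have h2 := radiusSlot_bounds hδ (zero_le_one.trans (h.radius_mem C hCA).1)
        have h3 := radiusSlot_bounds hδ (zero_le_one.trans (h.radius_mem C' hCA').1)
        rw [hCj] at h2
        rw [hCk] at h3
        have e : R = |(j * (δ / 2)) - k * (δ / 2)| := by
          rw [hR, ← sub_mul, abs_mul, abs_of_pos (half_pos hδ)]
        rw [e]
        refine (abs_abs_sub_abs_le _ _).trans (abs_le.2 ⟨by linarith, by linarith⟩)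
    _ = ∑ i ∈ Finset.range (scaleCount δ),
        60000 * δ ^ 2 / √((2 ^ (i + 1) * δ) * (R + 2 ^ (i + 1) * δ)) *
          incidences G H (fun C C' => |dist C.center C'.center - R| ≤ 2 ^ (i + 1) * δ) := by
        simp only [incidences_eq_sum_ite, Finset.mul_sum]
        rw [Finset.sum_congr rfl fun C _ => Finset.sum_comm, Finset.sum_comm]
    _ ≤ ∑ i ∈ Finset.range (scaleCount δ), 12000000 * δ * w := by
        refine Finset.sum_le_sum fun i _ => ?_
        have hp1 : 2 * δ ≤ 2 ^ (i + 1) * δ := by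
          have : (1 : ℝ) ≤ 2 ^ i := one_le_pow₀ (by norm_num)
          rw [pow_succ]
          nlinarith
        have hp : 0 < 2 ^ (i + 1) * δ := by positivity
        set p := (2 : ℝ) ^ (i + 1) * δ
        have hI := incidences_pow_six_le (δ := δ / 2) (ρ := p) (R := R) (half_pos hδ)
          (by linarith) hR0 (h.separatedPoints_radiusSlice hδ j)
          (h.separatedPoints_radiusSlice hδ k)
        rw [← hG, ← hH] at hI
        set I := incidences G H (fun C C' => |dist C.center C'.center - R| ≤ p) with hI_def
        have hI0 : 0 ≤ I := incidences_nonneg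
        set n := ((G.card : ℝ) * H.card) with hn
        have hn0 : 0 ≤ n := by positivity
        have hs : 0 < √(p * (R + p)) := Real.sqrt_pos.2 (by positivity)
        have hs2 : √(p * (R + p)) ^ 6 = (p * (R + p)) ^ 3 := by
          rw [show √(p * (R + p)) ^ 6 = (√(p * (R + p)) ^ 2) ^ 3 by ring,
            Real.sq_sqrt (by positivity)]
        have hκ : (1 + |(j : ℝ) - k|) * (δ / 2) ≤ R + p := by
          rw [hR]
          linarith
        -- The factor `p³` in the incidence bound cancels exactly against the sixth power of `√(p(R
        -- + p))`, leaving `(R + p)⁻²`, which `R + p ≥ (1 + |j - k|) δ/2` bounds uniformly in the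
        -- scale.
        have h200 : I / √(p * (R + p)) ≤ 200 / δ * w := by
          refine le_of_pow_le_pow_left₀ (n := 6) (by norm_num) (by positivity) ?_
          rw [div_pow, hs2, mul_pow (200 / δ), hw]
          have hk0 : 0 < 1 + |(j : ℝ) - k| := by positivity
          set κ := 1 + |(j : ℝ) - k|
          calc I ^ 6 / (p * (R + p)) ^ 3
              ≤ (1000000 ^ 2 * (p ^ 3 * (R + p) / (δ / 2) ^ 4) * n ^ 5) / (p * (R + p)) ^ 3 := by
                gcongr
            _ = 1000000 ^ 2 * n ^ 5 / ((δ / 2) ^ 4 * (R + p) ^ 2) := by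
                field_simp
            _ ≤ 1000000 ^ 2 * n ^ 5 / ((δ / 2) ^ 4 * (κ * (δ / 2)) ^ 2) := by
                gcongr
            _ = (200 / δ) ^ 6 * (n ^ 5 / κ ^ 2) := by
                field_simp
                ring
        calc 60000 * δ ^ 2 / √(p * (R + p)) * I = 60000 * δ ^ 2 * (I / √(p * (R + p))) := by ring
          _ ≤ 60000 * δ ^ 2 * (200 / δ * w) := by gcongr
          _ = 12000000 * δ * w := by
            field_simp
            ring
    _ = 12000000 * scaleCount δ * δ * w := by
        rw [Finset.sum_const, nsmul_eq_mul, Finset.card_range]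
        ring

theorem scaleCount_le {δ : ℝ} (hδ : 0 < δ) (hδ1 : δ < 1) :
    (scaleCount δ : ℝ) ≤ 7 * (1 + Real.log (1 / δ)) := by
  have h4 : 1 ≤ 4 / δ := by
    rw [le_div_iff₀ hδ]
    linarith
  have hf : 1 ≤ ⌊4 / δ⌋₊ := Nat.le_floor (by simpa using h4)
  have h0 : 0 ≤ Real.log (1 / δ) := Real.log_nonneg (by rw [le_div_iff₀ hδ]; linarith)
  have h1 : ((Nat.log 2 ⌊4 / δ⌋₊ : ℕ) : ℝ) ≤ Real.log ⌊4 / δ⌋₊ / Real.log 2 := by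
    have := Real.natLog_le_logb ⌊4 / δ⌋₊ 2
    simpa [Real.logb] using this
  have h2 : Real.log ⌊4 / δ⌋₊ ≤ Real.log 4 + Real.log (1 / δ) := by
    rw [← Real.log_mul (by norm_num) (by positivity), mul_one_div]
    exact Real.log_le_log (by exact_mod_cast hf) (Nat.floor_le (by positivity))
  have h3 : Real.log 4 ≤ 3 := by
    have := Real.log_le_sub_one_of_pos (show (0 : ℝ) < 4 by norm_num)
    linarith
  have h5 := Real.log_two_gt_d9
  have h6 : Real.log ⌊4 / δ⌋₊ / Real.log 2 ≤ 2 * (3 + Real.log (1 / δ)) := by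
    rw [div_le_iff₀ (by linarith)]
    nlinarith
  unfold scaleCount
  push_cast
  linarith

theorem sum_inv_slots_le {δ : ℝ} (hδ : 0 < δ) (hδ1 : δ < 1) {j : ℕ} (hj : j < ⌊4 / δ⌋₊ + 1) :
    ∑ k ∈ Finset.range (⌊4 / δ⌋₊ + 1), (1 + |(j : ℝ) - k|)⁻¹ ≤
      10 * (1 + Real.log (1 / δ)) := by
  have hlog : 0 ≤ Real.log (1 / δ) := Real.log_nonneg (by rw [le_div_iff₀ hδ]; linarith)
  refine (sum_inv_one_add_abs_sub_le hj).trans ?_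
  have h1 : ((⌊4 / δ⌋₊ + 1 : ℕ) : ℝ) ≤ 5 * (1 / δ) := by
    have := Nat.floor_le (show 0 ≤ 4 / δ by positivity)
    have h1δ : 1 ≤ 1 / δ := by
      rw [le_div_iff₀ hδ]
      linarith
    have e : 4 / δ = 4 * (1 / δ) := by ring
    push_cast
    linarith
  have h2 : Real.log ((⌊4 / δ⌋₊ + 1 : ℕ) : ℝ) ≤ Real.log 5 + Real.log (1 / δ) := by
    rw [← Real.log_mul (by norm_num) (by positivity)]
    exact Real.log_le_log (by positivity) h1
  have h3 := Real.log_le_sub_one_of_pos (show (0 : ℝ) < 5 by norm_num)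
  linarith

theorem sum_sum_rpow_le_of_sum_inv_le {N : ℕ} {a : ℕ → ℝ} (ha : ∀ j, 0 ≤ a j) {L : ℝ} (hL : 1 ≤ L)
    (hκL : ∀ j ∈ Finset.range N, ∑ k ∈ Finset.range N, (1 + |(j : ℝ) - k|)⁻¹ ≤ L) :
    ∑ j ∈ Finset.range N, ∑ k ∈ Finset.range N,
      ((a j * a k) ^ 5 / (1 + |(j : ℝ) - k|) ^ 2) ^ (1 / 6 : ℝ) ≤
        L * (∑ j ∈ Finset.range N, a j) ^ (5 / 3 : ℝ) := by
  have hA0 : 0 ≤ ∑ j ∈ Finset.range N, a j := Finset.sum_nonneg fun j _ => ha j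
  set A := ∑ j ∈ Finset.range N, a j with hA
  have hM3 : ((L * A ^ 5) ^ (1 / 3 : ℝ)) ^ 3 = L * A ^ 5 := by
    rw [← Real.rpow_natCast, ← Real.rpow_mul (by positivity)]
    norm_num
  have hML : (L * A ^ 5) ^ (1 / 3 : ℝ) ≤ L * A ^ (5 / 3 : ℝ) := by
    rw [Real.mul_rpow (by linarith) (by positivity), ← Real.rpow_natCast, ← Real.rpow_mul hA0]
    have : L ^ (1 / 3 : ℝ) ≤ L := by
      conv_rhs => rw [← Real.rpow_one L]
      exact Real.rpow_le_rpow_of_exponent_le hL (by norm_num)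
    norm_num
    gcongr
  refine (sum_sum_le_of_pow_six_le (κ := fun j k => 1 + |(j : ℝ) - k|) ha
    (fun j k => by positivity) (fun j k => by simp only [abs_sub_comm]) (by linarith) hκL
    (by positivity) hM3 fun j _ k _ => le_of_eq ?_).trans hML
  have hj := ha j
  have hk := ha k
  rw [← Real.rpow_natCast, ← Real.rpow_mul (by positivity)]
  norm_num

/-- The `L²` estimate: logarithmic form. -/
theorem IsLocalCircleFamily.sum_interArea_le {δ : ℝ} (hδ : 0 < δ) (hδ1 : δ < 1)
    {𝒜 : Finset PlaneCircle} (h : IsLocalCircleFamily δ 𝒜) :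
    ∑ C ∈ 𝒜, ∑ C' ∈ 𝒜, interArea δ C C' ≤
      840000000 * (1 + Real.log (1 / δ)) ^ 2 * δ * (𝒜.card : ℝ) ^ (5 / 3 : ℝ) := by
  have hlog : 0 ≤ Real.log (1 / δ) := Real.log_nonneg (by rw [le_div_iff₀ hδ]; linarith)
  have hslot : ∀ C ∈ 𝒜, radiusSlot δ C ∈ Finset.range (⌊4 / δ⌋₊ + 1) := by
    intro C hC
    rw [Finset.mem_range, Nat.lt_succ_iff]
    apply Nat.floor_mono
    have := (h.radius_mem C hC).2
    gcongr
    linarith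
  have hκL : ∀ j ∈ Finset.range (⌊4 / δ⌋₊ + 1), ∑ k ∈ Finset.range (⌊4 / δ⌋₊ + 1),
      (1 + |(j : ℝ) - k|)⁻¹ ≤ 10 * (1 + Real.log (1 / δ)) :=
    fun j hj => sum_inv_slots_le hδ hδ1 (Finset.mem_range.1 hj)
  generalize ⌊4 / δ⌋₊ + 1 = N at hslot hκL
  have hasum : ∑ j ∈ Finset.range N, ((radiusSlice δ 𝒜 j).card : ℝ) = 𝒜.card := by
    have := sum_eq_sum_radiusSlice hslot fun _ => (1 : ℝ)
    simpa using this.symm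
  have hyoung := sum_sum_rpow_le_of_sum_inv_le (a := fun j => ((radiusSlice δ 𝒜 j).card : ℝ))
    (fun j => Nat.cast_nonneg _) (by linarith) hκL
  rw [hasum] at hyoung
  calc ∑ C ∈ 𝒜, ∑ C' ∈ 𝒜, interArea δ C C'
      = ∑ j ∈ Finset.range N, ∑ k ∈ Finset.range N,
        ∑ C ∈ radiusSlice δ 𝒜 j, ∑ C' ∈ radiusSlice δ 𝒜 k, interArea δ C C' := by
        rw [sum_eq_sum_radiusSlice hslot]
        refine Finset.sum_congr rfl fun j _ => ?_
        conv_rhs => rw [Finset.sum_comm]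
        exact Finset.sum_congr rfl fun C _ => sum_eq_sum_radiusSlice hslot _
    _ ≤ ∑ j ∈ Finset.range N, ∑ k ∈ Finset.range N, 12000000 * scaleCount δ * δ *
          ((((radiusSlice δ 𝒜 j).card : ℝ) * (radiusSlice δ 𝒜 k).card) ^ 5 /
            (1 + |(j : ℝ) - k|) ^ 2) ^ (1 / 6 : ℝ) := by
        refine Finset.sum_le_sum fun j _ => Finset.sum_le_sum fun k _ =>
          h.sum_radiusSlice_le hδ hδ1 j k (by positivity) ?_
        rw [← Real.rpow_natCast, ← Real.rpow_mul (by positivity)]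
        norm_num
    _ = 12000000 * scaleCount δ * δ * ∑ j ∈ Finset.range N, ∑ k ∈ Finset.range N,
          ((((radiusSlice δ 𝒜 j).card : ℝ) * (radiusSlice δ 𝒜 k).card) ^ 5 /
            (1 + |(j : ℝ) - k|) ^ 2) ^ (1 / 6 : ℝ) := by
        simp only [Finset.mul_sum]
    _ ≤ 12000000 * (7 * (1 + Real.log (1 / δ))) * δ *
          (10 * (1 + Real.log (1 / δ)) * (𝒜.card : ℝ) ^ (5 / 3 : ℝ)) := by
        have h7 := scaleCount_le hδ hδ1
        refine mul_le_mul ?_ hyoung ?_ (by positivity)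
        · gcongr
        · exact Finset.sum_nonneg fun j _ => Finset.sum_nonneg fun k _ => by positivity
    _ = _ := by ring

theorem sq_one_add_log_le {δ η : ℝ} (hδ : 0 < δ) (hδ1 : δ < 1) (hη : 0 < η) :
    (1 + Real.log (1 / δ)) ^ 2 ≤ (1 + 2 / η) ^ 2 * δ ^ (-η) := by
  have hlog : 0 ≤ Real.log (1 / δ) := Real.log_nonneg (by rw [le_div_iff₀ hδ]; linarith)
  have h1 : Real.log (1 / δ) ≤ 2 / η * δ ^ (-(η / 2)) := by
    have := Real.log_le_rpow_div (x := 1 / δ) (by positivity) (half_pos hη)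
    rw [one_div, Real.inv_rpow hδ.le, ← Real.rpow_neg hδ.le] at this
    rw [one_div]
    calc Real.log δ⁻¹ ≤ δ ^ (-(η / 2)) / (η / 2) := this
      _ = _ := by field_simp
  have h2 : 1 ≤ δ ^ (-(η / 2)) := Real.one_le_rpow_of_pos_of_le_one_of_nonpos hδ hδ1.le (by linarith)
  have h3 : 1 + Real.log (1 / δ) ≤ (1 + 2 / η) * δ ^ (-(η / 2)) := by linarith
  calc (1 + Real.log (1 / δ)) ^ 2 ≤ ((1 + 2 / η) * δ ^ (-(η / 2))) ^ 2 := by gcongr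
    _ = (1 + 2 / η) ^ 2 * δ ^ (-η) := by
      rw [mul_pow, ← Real.rpow_natCast (δ ^ (-(η / 2))), ← Real.rpow_mul hδ.le]
      norm_num

/-- The `L²` estimate for the multiplicity function of a separated family of circles. -/
theorem exists_sum_interArea_le {η : ℝ} (hη : 0 < η) :
    ∃ K : ℝ, 0 < K ∧ ∀ δ : ℝ, 0 < δ → δ < 1 → ∀ 𝒜 : Finset PlaneCircle, IsLocalCircleFamily δ 𝒜 →
      ∑ C ∈ 𝒜, ∑ C' ∈ 𝒜, interArea δ C C' ≤ K * δ ^ (-η) * δ * (𝒜.card : ℝ) ^ (5 / 3 : ℝ) := by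
  refine ⟨840000000 * (1 + 2 / η) ^ 2, by positivity, fun δ hδ hδ1 𝒜 h𝒜 => ?_⟩
  refine (h𝒜.sum_interArea_le hδ hδ1).trans ?_
  have := sq_one_add_log_le hδ hδ1 hη
  rw [mul_assoc 840000000 _ (δ ^ (-η))]
  gcongr

/-! ### The multiplicity estimate and the circular means -/

theorem measurableSet_annulus (δ : ℝ) (C : PlaneCircle) : MeasurableSet (annulus δ C) :=
  Metric.isOpen_thickening.measurableSet

theorem volume_annulus_ne_top (δ : ℝ) (C : PlaneCircle) : volume (annulus δ C) ≠ ⊤ := by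
  refine ((measure_mono (t := Metric.closedBall C.center (C.radius + δ)) ?_).trans_lt
    measure_closedBall_lt_top).ne
  intro y hy
  have := (abs_le.1 (abs_dist_sub_le_of_mem_annulus hy)).2
  rw [Metric.mem_closedBall]
  linarith

/-- The radial projection of `y` onto the circle is at distance `|dist y C.center - C.radius|` from
`y`. -/
theorem mem_annulus_of_abs_dist_sub_lt {δ : ℝ} {C : PlaneCircle} (hC : 0 ≤ C.radius) {y : Plane}
    (hy : y ≠ C.center) (h : |dist y C.center - C.radius| < δ) : y ∈ annulus δ C := by
  have hd : 0 < dist y C.center := dist_pos.2 hy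
  have hn : ‖y - C.center‖ = dist y C.center := (dist_eq_norm _ _).symm
  rw [annulus, Metric.mem_thickening_iff]
  refine ⟨C.center + (C.radius / dist y C.center) • (y - C.center), ?_, ?_⟩
  · show dist _ C.center = C.radius
    rw [dist_eq_norm, add_sub_cancel_left, norm_smul, hn, Real.norm_eq_abs,
      abs_of_nonneg (by positivity)]
    field_simp
  · rw [dist_eq_norm]
    have e : y - (C.center + (C.radius / dist y C.center) • (y - C.center)) =
        (1 - C.radius / dist y C.center) • (y - C.center) := by
      rw [sub_smul, one_smul]
      abel
    rw [e, norm_smul, hn, Real.norm_eq_abs]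
    nth_rewrite 2 [← abs_of_pos hd]
    rw [← abs_mul]
    rwa [show (1 - C.radius / dist y C.center) * dist y C.center = dist y C.center - C.radius by
      field_simp]

theorem le_volume_annulus {δ : ℝ} (hδ : 0 < δ) (hδ1 : δ < 1) {C : PlaneCircle}
    (hC : 1 ≤ C.radius) : ENNReal.ofReal (8 * δ) ≤ volume (annulus δ C) := by
  have hsub : Metric.ball C.center (C.radius + δ) \ Metric.closedBall C.center (C.radius - δ) ⊆
      annulus δ C := by
    intro y hy
    simp only [Set.mem_sdiff, Metric.mem_ball, Metric.mem_closedBall, not_le] at hy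
    refine mem_annulus_of_abs_dist_sub_lt (by linarith) ?_ (abs_lt.2 ⟨by linarith, by linarith⟩)
    exact dist_pos.1 (lt_of_le_of_lt (by linarith) hy.2)
  refine le_trans ?_ (measure_mono hsub)
  rw [measure_sdiff (Metric.closedBall_subset_ball (by linarith))
    Metric.isClosed_closedBall.measurableSet.nullMeasurableSet measure_closedBall_lt_top.ne,
    EuclideanSpace.volume_closedBall_fin_two, EuclideanSpace.volume_ball_fin_two,
    ← ENNReal.ofReal_pow (by positivity), ← ENNReal.ofReal_mul (by positivity),
    ← ENNReal.ofReal_pow (by linarith), ← ENNReal.ofReal_mul (by positivity),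
    ← ENNReal.ofReal_sub _ (by positivity)]
  apply ENNReal.ofReal_le_ofReal
  have h2 : (4 * (C.radius * δ)) * 2 ≤ (4 * (C.radius * δ)) * Real.pi := by
    gcongr
    exact Real.two_le_pi
  nlinarith

/-- The multiplicity function with values in `[0, ∞]`. -/
noncomputable def circleMultiplicityENN (δ : ℝ) (𝒜 : Finset PlaneCircle) (y : Plane) : ENNReal :=
  ∑ C ∈ 𝒜, (annulus δ C).indicator 1 y

theorem ofReal_circleMultiplicity (δ : ℝ) (𝒜 : Finset PlaneCircle) (y : Plane) :
    ENNReal.ofReal (circleMultiplicity δ 𝒜 y) = circleMultiplicityENN δ 𝒜 y := by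
  unfold circleMultiplicity circleMultiplicityENN
  rw [ENNReal.ofReal_sum_of_nonneg fun C _ => Set.indicator_nonneg (fun _ _ => zero_le_one) _]
  refine Finset.sum_congr rfl fun C _ => ?_
  by_cases h : y ∈ annulus δ C <;> simp [h]

theorem measurable_circleMultiplicityENN (δ : ℝ) (𝒜 : Finset PlaneCircle) :
    Measurable (circleMultiplicityENN δ 𝒜) :=
  Finset.measurable_fun_sum _ fun C _ => measurable_one.indicator (measurableSet_annulus δ C)

theorem lintegral_circleMultiplicityENN (δ : ℝ) (𝒜 : Finset PlaneCircle) (μ : Measure Plane) :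
    ∫⁻ y, circleMultiplicityENN δ 𝒜 y ∂μ = ∑ C ∈ 𝒜, μ (annulus δ C) := by
  unfold circleMultiplicityENN
  rw [lintegral_finsetSum _ fun C _ => measurable_one.indicator (measurableSet_annulus δ C)]
  exact Finset.sum_congr rfl fun C _ => lintegral_indicator_one (measurableSet_annulus δ C)

theorem volume_inter_annulus_eq (δ : ℝ) (C C' : PlaneCircle) :
    volume (annulus δ C ∩ annulus δ C') = ENNReal.ofReal (interArea δ C C') :=
  (ENNReal.ofReal_toReal
    (ne_top_of_le_ne_top (volume_annulus_ne_top δ C) (measure_mono Set.inter_subset_left))).symm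

theorem lintegral_circleMultiplicityENN_sq (δ : ℝ) (𝒜 : Finset PlaneCircle) :
    ∫⁻ y, circleMultiplicityENN δ 𝒜 y ^ 2 =
      ENNReal.ofReal (∑ C ∈ 𝒜, ∑ C' ∈ 𝒜, interArea δ C C') := by
  have h1 : ∀ y, circleMultiplicityENN δ 𝒜 y ^ 2 =
      ∑ C ∈ 𝒜, ∑ C' ∈ 𝒜, (annulus δ C ∩ annulus δ C').indicator (1 : Plane → ENNReal) y := by
    intro y
    rw [sq, circleMultiplicityENN, Finset.sum_mul_sum]
    refine Finset.sum_congr rfl fun C _ => Finset.sum_congr rfl fun C' _ => ?_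
    rw [← Set.inter_indicator_mul]
    simp
    rfl
  have hm : ∀ C C', MeasurableSet (annulus δ C ∩ annulus δ C') := fun C C' =>
    (measurableSet_annulus δ C).inter (measurableSet_annulus δ C')
  simp only [h1]
  rw [lintegral_finsetSum _ fun C _ => Finset.measurable_fun_sum _ fun C' _ =>
      measurable_one.indicator (hm C C'),
    ENNReal.ofReal_sum_of_nonneg fun C _ => Finset.sum_nonneg fun C' _ => interArea_nonneg _ _ _]
  refine Finset.sum_congr rfl fun C _ => ?_
  rw [lintegral_finsetSum _ fun C' _ => measurable_one.indicator (hm C C'),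
    ENNReal.ofReal_sum_of_nonneg fun C' _ => interArea_nonneg _ _ _]
  refine Finset.sum_congr rfl fun C' _ => ?_
  rw [lintegral_indicator_one (hm C C'), volume_inter_annulus_eq]

theorem volume_multiplicity_gt_le (δ : ℝ) (𝒜 : Finset PlaneCircle) (C : PlaneCircle) {X : ℝ}
    (hX : 0 < X) :
    volume {y ∈ annulus δ C | circleMultiplicity δ 𝒜 y > X} ≤
      ENNReal.ofReal ((∑ C' ∈ 𝒜, interArea δ C C') / X) := by
  have hX' : ENNReal.ofReal X ≠ 0 := by simpa using hX
  have h1 : volume {y ∈ annulus δ C | circleMultiplicity δ 𝒜 y > X} ≤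
      volume.restrict (annulus δ C) {y | ENNReal.ofReal X ≤ circleMultiplicityENN δ 𝒜 y} := by
    refine le_trans (measure_mono ?_) (Measure.le_restrict_apply _ _)
    rintro y ⟨h1, h2⟩
    refine ⟨?_, h1⟩
    show ENNReal.ofReal X ≤ circleMultiplicityENN δ 𝒜 y
    rw [← ofReal_circleMultiplicity]
    exact ENNReal.ofReal_le_ofReal (le_of_lt h2)
  refine h1.trans ((meas_ge_le_lintegral_div (measurable_circleMultiplicityENN δ 𝒜).aemeasurable
    hX' ENNReal.ofReal_ne_top).trans ?_)
  rw [lintegral_circleMultiplicityENN, ENNReal.ofReal_div_of_pos hX,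
    ENNReal.ofReal_sum_of_nonneg fun C' _ => interArea_nonneg _ _ _]
  gcongr with C' hC'
  rw [Measure.restrict_apply (measurableSet_annulus δ C'), Set.inter_comm, volume_inter_annulus_eq]

/-! ### Selection of a large subfamily with controlled multiplicity. -/

theorem IsSeparatedCircleFamily.isLocalCircleFamily {δ : ℝ} {𝒞 : Finset PlaneCircle}
    (h : IsSeparatedCircleFamily δ 𝒞) : IsLocalCircleFamily δ 𝒞 := by
  refine ⟨h.radius_mem, fun C hC C' hC' => ?_, h.separated⟩
  have e := plane_dist_sq C.center C'.center
  have h0 := h.center_mem C hC 0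
  have h1 := h.center_mem C hC 1
  have h0' := h.center_mem C' hC' 0
  have h1' := h.center_mem C' hC' 1
  have a0 : (C.center 0 - C'.center 0) ^ 2 ≤ 1 := by
    rw [sq_le_one_iff_abs_le_one]
    exact abs_le.2 ⟨by linarith [h0.1, h0'.2], by linarith [h0.2, h0'.1]⟩
  have a1 : (C.center 1 - C'.center 1) ^ 2 ≤ 1 := by
    rw [sq_le_one_iff_abs_le_one]
    exact abs_le.2 ⟨by linarith [h1.1, h1'.2], by linarith [h1.2, h1'.1]⟩
  apply le_of_sq_le_sq _ (by norm_num)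
  linarith

theorem exists_subfamily_multiplicity_le {η : ℝ} (hη : 0 < η) (hη1 : η < 1) :
    ∃ δ₀ : ℝ, 0 < δ₀ ∧ ∀ δ : ℝ, 0 < δ → δ < δ₀ →
      ∀ 𝒞 : Finset PlaneCircle, 𝒞.Nonempty → IsSeparatedCircleFamily δ 𝒞 →
        ∃ 𝒜 : Finset PlaneCircle, 𝒜 ⊆ 𝒞 ∧ (𝒜.card : ℝ) > η * (𝒞.card : ℝ) ∧
          ∀ C ∈ 𝒜, ∀ lam : ℝ, 0 < lam → lam < 1 →
            volume {y ∈ annulus δ C |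
                circleMultiplicity δ 𝒜 y > δ ^ (-(4 * η)) * lam⁻¹ * (𝒜.card : ℝ) ^ (2 / 3 : ℝ)}
              ≤ ENNReal.ofReal lam * volume (annulus δ C) := by
  classical
  obtain ⟨K, hK, hsum⟩ := exists_sum_interArea_le hη
  have hη2 : 0 < 1 - η := by linarith
  set Q := 2 * K / (1 - η) * (1 / η) ^ (2 / 3 : ℝ) with hQ
  have hQ0 : 0 < Q := by positivity
  -- The `L²` bound loses only `δ^(-η)` while the claim allows `δ^(-4η)`; for such `δ` the spare
  -- factor `δ^(3η)` swallows the constant `Q`.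
  refine ⟨min (1 / 2) ((1 / Q) ^ (1 / (3 * η))), by positivity, fun δ hδ hδ0 𝒞 h𝒞 hsep => ?_⟩
  have hδ1 : δ < 1 := by
    have := hδ0.trans_le (min_le_left _ _)
    linarith
  have hδQ : Q * δ ^ (3 * η) ≤ 1 := by
    have h1 := (hδ0.trans_le (min_le_right _ _)).le
    have h2 := Real.rpow_le_rpow hδ.le h1 (show 0 ≤ 3 * η by positivity)
    rw [← Real.rpow_mul (by positivity), one_div_mul_cancel (by positivity), Real.rpow_one,
      le_div_iff₀ hQ0] at h2
    linarith
  have hn : (0 : ℝ) < 𝒞.card := by exact_mod_cast h𝒞.card_pos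
  have htot := hsum δ hδ hδ1 𝒞 hsep.isLocalCircleFamily
  set n := (𝒞.card : ℝ) with hn_def
  -- A threshold `2/(1 - η)` times the bound on the average of `W`, so that by Markov at most a
  -- fraction `(1 - η)/2` of the circles exceeds it.
  set T := 2 * K / (1 - η) * δ ^ (-η) * δ * n ^ (2 / 3 : ℝ) with hT
  have hT0 : 0 < T := by positivity
  set W : PlaneCircle → ℝ := fun C => ∑ C' ∈ 𝒞, interArea δ C C' with hW
  have hW0 : ∀ C, 0 ≤ W C := fun C => Finset.sum_nonneg fun _ _ => interArea_nonneg _ _ _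
  have hcard : η * n < ((𝒞.filter fun C => W C ≤ T).card : ℝ) := by
    have h1 := Finset.card_filter_add_card_filter_not (s := 𝒞) fun C => W C ≤ T
    have h2 : ((𝒞.filter fun C => ¬W C ≤ T).card : ℝ) * T ≤ ∑ C ∈ 𝒞, W C := by
      rw [← nsmul_eq_mul]
      refine (Finset.card_nsmul_le_sum _ W T fun C hC => ?_).trans
        (Finset.sum_le_sum_of_subset_of_nonneg (Finset.filter_subset _ _) fun C _ _ => hW0 C)
      exact (not_le.1 (Finset.mem_filter.1 hC).2).le
    have h3 : K * δ ^ (-η) * δ * n ^ (5 / 3 : ℝ) = (1 - η) / 2 * n * T := by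
      rw [show (5 / 3 : ℝ) = 1 + 2 / 3 by norm_num, Real.rpow_add hn, Real.rpow_one, hT]
      field_simp
    have h4 : ((𝒞.filter fun C => ¬W C ≤ T).card : ℝ) ≤ (1 - η) / 2 * n :=
      le_of_mul_le_mul_right (h2.trans (htot.trans h3.le)) hT0
    have h5 : ((𝒞.filter fun C => W C ≤ T).card : ℝ) +
        ((𝒞.filter fun C => ¬W C ≤ T).card : ℝ) = n := by
      rw [hn_def, ← h1]
      push_cast
      rfl
    nlinarith
  refine ⟨𝒞.filter fun C => W C ≤ T, Finset.filter_subset _ _, hcard, ?_⟩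
  intro C hC lam hlam _
  have hWC : W C ≤ T := (Finset.mem_filter.1 hC).2
  have hsub : (𝒞.filter fun C => W C ≤ T) ⊆ 𝒞 := Finset.filter_subset _ _
  have hCr := (hsep.radius_mem C (hsub hC)).1
  set 𝒜 := 𝒞.filter fun C => W C ≤ T with h𝒜
  set m := (𝒜.card : ℝ) with hm
  have hm0 : 0 < m := lt_trans (by positivity) hcard
  have hX : 0 < δ ^ (-(4 * η)) * lam⁻¹ * m ^ (2 / 3 : ℝ) := by positivity
  refine (volume_multiplicity_gt_le δ 𝒜 C hX).trans ?_
  calc ENNReal.ofReal ((∑ C' ∈ 𝒜, interArea δ C C') / (δ ^ (-(4 * η)) * lam⁻¹ * m ^ (2 / 3 : ℝ)))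
      ≤ ENNReal.ofReal (lam * (8 * δ)) := by
        apply ENNReal.ofReal_le_ofReal
        rw [div_le_iff₀ hX]
        have h1 : ∑ C' ∈ 𝒜, interArea δ C C' ≤ W C :=
          Finset.sum_le_sum_of_subset_of_nonneg hsub fun _ _ _ => interArea_nonneg _ _ _
        have h2 : n ^ (2 / 3 : ℝ) ≤ (1 / η) ^ (2 / 3 : ℝ) * m ^ (2 / 3 : ℝ) := by
          rw [← Real.mul_rpow (by positivity) hm0.le]
          apply Real.rpow_le_rpow hn.le _ (by norm_num)
          rw [one_div, inv_mul_eq_div, le_div_iff₀ hη]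
          linarith
        have h3 : δ ^ (-η) = δ ^ (-(4 * η)) * δ ^ (3 * η) := by
          rw [← Real.rpow_add hδ]
          congr 1
          ring
        calc ∑ C' ∈ 𝒜, interArea δ C C' ≤ T := h1.trans hWC
          _ ≤ 2 * K / (1 - η) * δ ^ (-η) * δ * ((1 / η) ^ (2 / 3 : ℝ) * m ^ (2 / 3 : ℝ)) := by
            rw [hT]
            gcongr
          _ = (Q * δ ^ (3 * η)) * (δ ^ (-(4 * η)) * δ * m ^ (2 / 3 : ℝ)) := by
            rw [h3, hQ]
            ring
          _ ≤ 8 * (δ ^ (-(4 * η)) * δ * m ^ (2 / 3 : ℝ)) := by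
            gcongr
            linarith
          _ = lam * (8 * δ) * (δ ^ (-(4 * η)) * lam⁻¹ * m ^ (2 / 3 : ℝ)) := by
            field_simp
    _ = ENNReal.ofReal lam * ENNReal.ofReal (8 * δ) := ENNReal.ofReal_mul hlam.le
    _ ≤ ENNReal.ofReal lam * volume (annulus δ C) := by
        gcongr
        exact le_volume_annulus hδ hδ1 hCr

/-! ### The restricted weak-type bound, by discretising the superlevel set. -/

theorem circularMean_indicator_eq {E : Set Plane} (hE : NullMeasurableSet E volume) (δ : ℝ)
    (p : Plane × ℝ) : circularMean δ (E.indicator fun _ => (1 : ℝ)) p =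
      volume.real (E ∩ annulus δ ⟨p.1, p.2⟩) / volume.real (annulus δ ⟨p.1, p.2⟩) := by
  have hE' : NullMeasurableSet E (volume.restrict (annulus δ ⟨p.1, p.2⟩)) :=
    hE.mono_ac Measure.restrict_le_self.absolutelyContinuous
  rw [circularMean, setAverage_eq, integral_indicator₀ hE', setIntegral_const,
    measureReal_restrict_apply₀ hE', smul_eq_mul, smul_eq_mul, mul_one, inv_mul_eq_div]

/-- The sum is the integral of the multiplicity function over `E`, so this is Cauchy–Schwarz against
the indicator of `E`. -/
theorem sq_sum_volume_inter_le {E : Set Plane} (hE : volume E ≠ ⊤) (δ : ℝ)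
    (𝒜 : Finset PlaneCircle) :
    (∑ C ∈ 𝒜, volume.real (E ∩ annulus δ C)) ^ 2 ≤
      volume.real E * ∑ C ∈ 𝒜, ∑ C' ∈ 𝒜, interArea δ C C' := by
  have hQ0 : 0 ≤ ∑ C ∈ 𝒜, ∑ C' ∈ 𝒜, interArea δ C C' :=
    Finset.sum_nonneg fun _ _ => Finset.sum_nonneg fun _ _ => interArea_nonneg _ _ _
  set Q := ∑ C ∈ 𝒜, ∑ C' ∈ 𝒜, interArea δ C C' with hQ
  have h1 := ENNReal.lintegral_mul_le_Lp_mul_Lq (volume.restrict E) Real.HolderConjugate.two_two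
    (measurable_circleMultiplicityENN δ 𝒜).aemeasurable (g := 1) aemeasurable_one
  have h2 : ∫⁻ y in E, circleMultiplicityENN δ 𝒜 y ^ (2 : ℝ) ≤ ENNReal.ofReal Q := by
    rw [hQ, ← lintegral_circleMultiplicityENN_sq]
    simp only [ENNReal.rpow_two]
    exact setLIntegral_le_lintegral _ _
  have h3 : ∫⁻ y in E, ((1 : Plane → ENNReal) y) ^ (2 : ℝ) = ENNReal.ofReal (volume.real E) := by
    simp [measureReal_def, hE]
  rw [mul_one, lintegral_circleMultiplicityENN, h3] at h1
  have h4 : ∑ C ∈ 𝒜, volume.restrict E (annulus δ C) =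
      ENNReal.ofReal (∑ C ∈ 𝒜, volume.real (E ∩ annulus δ C)) := by
    rw [ENNReal.ofReal_sum_of_nonneg fun _ _ => measureReal_nonneg]
    refine Finset.sum_congr rfl fun C _ => ?_
    rw [Measure.restrict_apply (measurableSet_annulus δ C), Set.inter_comm, measureReal_def,
      ENNReal.ofReal_toReal (ne_top_of_le_ne_top hE (measure_mono Set.inter_subset_left))]
  rw [h4] at h1
  have h5 : ENNReal.ofReal (∑ C ∈ 𝒜, volume.real (E ∩ annulus δ C)) ≤
      ENNReal.ofReal (√Q * √(volume.real E)) := by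
    refine h1.trans ?_
    rw [ENNReal.ofReal_mul (Real.sqrt_nonneg _), Real.sqrt_eq_rpow, Real.sqrt_eq_rpow,
      ← ENNReal.ofReal_rpow_of_nonneg hQ0 (by norm_num),
      ← ENNReal.ofReal_rpow_of_nonneg measureReal_nonneg (by norm_num)]
    gcongr
  rw [ENNReal.ofReal_le_ofReal_iff (by positivity)] at h5
  calc (∑ C ∈ 𝒜, volume.real (E ∩ annulus δ C)) ^ 2 ≤ (√Q * √(volume.real E)) ^ 2 := by
        apply pow_le_pow_left₀ (Finset.sum_nonneg fun _ _ => measureReal_nonneg) h5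
    _ = volume.real E * Q := by
        rw [mul_pow, Real.sq_sqrt hQ0, Real.sq_sqrt measureReal_nonneg, mul_comm]

theorem le_cube_of_sq_le_rpow {n Y : ℝ} (hn : 0 ≤ n) (hY : 0 ≤ Y)
    (h : n ^ 2 ≤ Y * n ^ (5 / 3 : ℝ)) : n ≤ Y ^ 3 := by
  rcases hn.eq_or_lt with h0 | h0
  · rw [← h0]
    positivity
  have h1 : n ^ 2 = n ^ (1 / 3 : ℝ) * n ^ (5 / 3 : ℝ) := by
    rw [← Real.rpow_add h0, ← Real.rpow_natCast]
    norm_num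
  rw [h1] at h
  have h2 := le_of_mul_le_mul_right h (by positivity)
  calc n = (n ^ (1 / 3 : ℝ)) ^ 3 := by
        rw [← Real.rpow_natCast, ← Real.rpow_mul hn]
        norm_num
    _ ≤ Y ^ 3 := by gcongr

/-- A bounded set of parameters in which separated subsets have at most `B` elements. -/
theorem volume_le_of_card_le {δ B : ℝ} (hδ : 0 < δ) (G : Set (Plane × ℝ))
    (hG : ∀ 𝒜 : Finset PlaneCircle, (∀ C ∈ 𝒜, (C.center, C.radius) ∈ G) →
      (∀ C ∈ 𝒜, ∀ C' ∈ 𝒜, C ≠ C' → δ < circleDist C C') → (𝒜.card : ℝ) ≤ B) :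
    volume G ≤ ENNReal.ofReal (8 * δ ^ 3 * B) := by
  classical
  set S : Set ℕ := {k | ∃ 𝒜 : Finset PlaneCircle, (∀ C ∈ 𝒜, (C.center, C.radius) ∈ G) ∧
    (∀ C ∈ 𝒜, ∀ C' ∈ 𝒜, C ≠ C' → δ < circleDist C C') ∧ 𝒜.card = k} with hS
  have hbdd : BddAbove S := by
    refine ⟨⌊B⌋₊, ?_⟩
    rintro k ⟨𝒜, h1, h2, rfl⟩
    exact Nat.le_floor (hG 𝒜 h1 h2)
  have hne : S.Nonempty := ⟨0, ∅, by simp⟩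
  -- A separated subset of maximal size is a `δ`-net; otherwise a missed point could be added to it.
  obtain ⟨𝒜, h1, h2, h3⟩ := Nat.sSup_mem hne hbdd
  have hcover : G ⊆ ⋃ C ∈ 𝒜, Metric.closedBall C.center δ ×ˢ Metric.closedBall C.radius δ := by
    rintro ⟨x, t⟩ hp
    by_contra hcon
    simp only [Set.mem_iUnion, Set.mem_prod, Metric.mem_closedBall, not_exists, not_and,
      not_le, Real.dist_eq] at hcon
    have hfar : ∀ C ∈ 𝒜, δ < dist x C.center + |t - C.radius| := by
      intro C hC
      rcases le_or_gt (dist x C.center) δ with h | h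
      · have := hcon C hC h
        linarith [dist_nonneg (x := x) (y := C.center)]
      · linarith [abs_nonneg (t - C.radius)]
    have hnot : (⟨x, t⟩ : PlaneCircle) ∉ 𝒜 := by
      intro hmem
      have := hfar _ hmem
      simp at this
      linarith
    have hmem : (insert (⟨x, t⟩ : PlaneCircle) 𝒜).card ∈ S := by
      refine ⟨_, ?_, ?_, rfl⟩
      · intro C hC
        rcases Finset.mem_insert.1 hC with rfl | hC
        · exact hp
        · exact h1 C hC
      · intro C hC C' hC' hne
        rcases Finset.mem_insert.1 hC with rfl | hC <;>
          rcases Finset.mem_insert.1 hC' with rfl | hC'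
        · exact absurd rfl hne
        · exact hfar C' hC'
        · have := hfar C hC
          unfold circleDist
          rwa [dist_comm, abs_sub_comm]
        · exact h2 C hC C' hC' hne
    have := le_csSup hbdd hmem
    rw [Finset.card_insert_of_notMem hnot, ← h3] at this
    omega
  calc volume G ≤ ∑ C ∈ 𝒜, volume (Metric.closedBall C.center δ ×ˢ Metric.closedBall C.radius δ) :=
        (measure_mono hcover).trans (measure_biUnion_finset_le _ _)
    _ ≤ ∑ C ∈ 𝒜, ENNReal.ofReal (8 * δ ^ 3) := by
        refine Finset.sum_le_sum fun C _ => ?_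
        rw [Measure.volume_eq_prod, Measure.prod_prod, EuclideanSpace.volume_closedBall_fin_two,
          Real.volume_closedBall, ← ENNReal.ofReal_pow hδ.le, ← ENNReal.ofReal_mul (by positivity),
          ← ENNReal.ofReal_mul (by positivity)]
        apply ENNReal.ofReal_le_ofReal
        calc δ ^ 2 * Real.pi * (2 * δ) ≤ δ ^ 2 * 4 * (2 * δ) := by
              gcongr
              exact Real.pi_le_four
          _ = 8 * δ ^ 3 := by ring
    _ = ENNReal.ofReal (8 * δ ^ 3 * 𝒜.card) := by
        rw [Finset.sum_const, nsmul_eq_mul, mul_comm,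
          ENNReal.ofReal_mul (p := 8 * δ ^ 3) (by positivity), ENNReal.ofReal_natCast]
    _ ≤ ENNReal.ofReal (8 * δ ^ 3 * B) := by
        apply ENNReal.ofReal_le_ofReal
        have := hG 𝒜 h1 h2
        gcongr

theorem plane_abs_sub_le_dist (x y : Plane) (i : Fin 2) : |x i - y i| ≤ dist x y := by
  have h := plane_dist_sq x y
  apply abs_le_of_sq_le_sq _ dist_nonneg
  fin_cases i
  · show (x 0 - y 0) ^ 2 ≤ _
    nlinarith [sq_nonneg (x 1 - y 1)]
  · show (x 1 - y 1) ^ 2 ≤ _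
    nlinarith [sq_nonneg (x 0 - y 0)]

theorem circularMeanSuperlevel_spec {δ lam : ℝ} (hδ : 0 < δ) (hδ1 : δ < 1) {E : Set Plane}
    (hE : NullMeasurableSet E volume) (hE1 : ∀ y ∈ E, ∀ i, y i ∈ Set.Icc (0 : ℝ) 1)
    (hlam : 0 < lam) {p : Plane × ℝ} (hp : p ∈ circularMeanSuperlevel δ lam E) :
    p.2 ∈ Set.Icc (1 : ℝ) 2 ∧ (∀ i, p.1 i ∈ Set.Icc (-3 : ℝ) 4) ∧
      8 * lam * δ ≤ volume.real (E ∩ annulus δ ⟨p.1, p.2⟩) := by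
  obtain ⟨h1, h2⟩ := hp
  rw [circularMean_indicator_eq hE] at h2
  have h3 : 8 * δ ≤ volume.real (annulus δ ⟨p.1, p.2⟩) :=
    (ENNReal.ofReal_le_iff_le_toReal (volume_annulus_ne_top _ _)).1
      (le_volume_annulus hδ hδ1 h1.1)
  rw [lt_div_iff₀ (by linarith)] at h2
  have h4 : 8 * lam * δ ≤ volume.real (E ∩ annulus δ ⟨p.1, p.2⟩) := by nlinarith
  refine ⟨h1, fun i => ?_, h4⟩
  have hne : (E ∩ annulus δ ⟨p.1, p.2⟩).Nonempty := by
    by_contra hemp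
    rw [Set.not_nonempty_iff_eq_empty] at hemp
    rw [hemp, measureReal_empty] at h4
    have : 0 < lam * δ := by positivity
    linarith
  obtain ⟨y, hyE, hyA⟩ := hne
  have h5 := (abs_le.1 (abs_dist_sub_le_of_mem_annulus hyA)).2
  have h6 := abs_le.1 (plane_abs_sub_le_dist y p.1 i)
  have h7 := hE1 y hyE i
  have h8 := h1.2
  simp only at h5
  constructor <;> linarith [h7.1, h7.2]

theorem circularMean_restricted_weak_type {η : ℝ} (hη : 0 < η) :
    ∃ K : ℝ, 0 < K ∧ ∀ δ : ℝ, 0 < δ → δ < 1 →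
      ∀ E : Set Plane, NullMeasurableSet E volume → (∀ y ∈ E, ∀ i, y i ∈ Set.Icc (0 : ℝ) 1) →
        ∀ lam : ℝ, 0 < lam →
          ENNReal.ofReal lam * volume (circularMeanSuperlevel δ lam E) ^ (1 / 6 : ℝ)
            ≤ ENNReal.ofReal (K * δ ^ (-η)) * volume E ^ (1 / 2 : ℝ) := by
  -- The `L²` bound enters through its square root, so a loss of `2η` is affordable.
  obtain ⟨K, hK, hsum⟩ := exists_sum_interArea_le (show 0 < 2 * η by linarith)
  refine ⟨√K, by positivity, fun δ hδ hδ1 E hE hE1 lam hlam => ?_⟩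
  have hEtop : volume E ≠ ⊤ := by
    refine ((measure_mono (t := Metric.closedBall (0 : Plane) 2) fun y hy => ?_).trans_lt
      measure_closedBall_lt_top).ne
    rw [Metric.mem_closedBall]
    have e := plane_dist_sq y 0
    have h0 := hE1 y hy 0
    have h1 := hE1 y hy 1
    apply le_of_sq_le_sq _ (by norm_num)
    rw [e]
    simp only [PiLp.zero_apply, sub_zero]
    nlinarith [h0.1, h0.2, h1.1, h1.2]
  have he0 : 0 ≤ volume.real E := measureReal_nonneg
  set e := volume.real E with he
  set Y := K * δ ^ (-(2 * η)) * e / (64 * lam ^ 2 * δ) with hY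
  have hY0 : 0 ≤ Y := by positivity
  set F := circularMeanSuperlevel δ lam E with hF
  have hspec := fun p (hp : p ∈ F) => circularMeanSuperlevel_spec hδ hδ1 hE hE1 hlam hp
  -- Within a unit square of centres distances are at most `√2 ≤ 3/2`, as the `L²` bound requires. A
  -- separated family of `n` circles there satisfies `(8 lam δ n)² ≤ |E| K δ^(1-2η) n^(5/3)`, that
  -- is `n ≤ Y³`.
  have hblock : ∀ c : ℤ × ℤ, volume {p ∈ F | ⌊p.1 0⌋ = c.1 ∧ ⌊p.1 1⌋ = c.2} ≤
      ENNReal.ofReal (8 * δ ^ 3 * Y ^ 3) := by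
    intro c
    refine volume_le_of_card_le hδ _ fun 𝒜 h1 h2 => ?_
    have hloc : IsLocalCircleFamily δ 𝒜 := by
      refine ⟨fun C hC => (hspec _ (h1 C hC).1).1, fun C hC C' hC' => ?_, h2⟩
      obtain ⟨-, f0, f1⟩ := h1 C hC
      obtain ⟨-, f0', f1'⟩ := h1 C' hC'
      have a0 := Int.abs_sub_lt_one_of_floor_eq_floor (f0.trans f0'.symm)
      have a1 := Int.abs_sub_lt_one_of_floor_eq_floor (f1.trans f1'.symm)
      have ed := plane_dist_sq C.center C'.center
      have b0 := (sq_le_one_iff_abs_le_one _).2 a0.le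
      have b1 := (sq_le_one_iff_abs_le_one _).2 a1.le
      simp only at b0 b1
      apply le_of_sq_le_sq _ (by norm_num)
      linarith
    have hCS := sq_sum_volume_inter_le hEtop δ 𝒜
    rw [← he] at hCS
    have hlow : 8 * lam * δ * 𝒜.card ≤ ∑ C ∈ 𝒜, volume.real (E ∩ annulus δ C) := by
      rw [mul_comm, ← nsmul_eq_mul]
      exact Finset.card_nsmul_le_sum _ _ _ fun C hC => (hspec _ (h1 C hC).1).2.2
    apply le_cube_of_sq_le_rpow (Nat.cast_nonneg _) hY0
    have h5 : (8 * lam * δ * 𝒜.card) ^ 2 ≤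
        e * (K * δ ^ (-(2 * η)) * δ * (𝒜.card : ℝ) ^ (5 / 3 : ℝ)) := by
      refine (pow_le_pow_left₀ (by positivity) hlow 2).trans (hCS.trans ?_)
      gcongr
      exact hsum δ hδ hδ1 𝒜 hloc
    rw [hY, div_mul_eq_mul_div, le_div_iff₀ (by positivity)]
    refine le_of_mul_le_mul_right ?_ hδ
    calc (𝒜.card : ℝ) ^ 2 * (64 * lam ^ 2 * δ) * δ = (8 * lam * δ * 𝒜.card) ^ 2 := by ring
      _ ≤ _ := h5
      _ = _ := by ring
  have hvol : volume F ≤ ENNReal.ofReal ((K * δ ^ (-(2 * η)) * e / lam ^ 2) ^ 3) := by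
    -- The `64` unit squares that can contain centres of annuli meeting `[0,1]²`, since radius plus
    -- thickness is below `3`.
    set I := Finset.Icc (-3 : ℤ) 4 ×ˢ Finset.Icc (-3 : ℤ) 4 with hI
    have hcov : F ⊆ ⋃ c ∈ I, {p ∈ F | ⌊p.1 0⌋ = c.1 ∧ ⌊p.1 1⌋ = c.2} := by
      intro p hp
      have hb : ∀ i, ⌊p.1 i⌋ ∈ Finset.Icc (-3 : ℤ) 4 := by
        intro i
        obtain ⟨h1, h2⟩ := (hspec p hp).2.1 i
        rw [Finset.mem_Icc]
        constructor
        · rw [Int.le_floor]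
          exact_mod_cast h1
        · have := Int.floor_le (p.1 i)
          have h3 : ((⌊p.1 i⌋ : ℤ) : ℝ) ≤ (4 : ℤ) := by
            push_cast
            linarith
          exact_mod_cast h3
      simp only [Set.mem_iUnion]
      exact ⟨(⌊p.1 0⌋, ⌊p.1 1⌋), Finset.mem_product.2 ⟨hb 0, hb 1⟩, hp, rfl, rfl⟩
    calc volume F ≤ ∑ c ∈ I, volume {p ∈ F | ⌊p.1 0⌋ = c.1 ∧ ⌊p.1 1⌋ = c.2} :=
          (measure_mono hcov).trans (measure_biUnion_finset_le _ _)
      _ ≤ ∑ c ∈ I, ENNReal.ofReal (8 * δ ^ 3 * Y ^ 3) := Finset.sum_le_sum fun c _ => hblock c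
      _ = ENNReal.ofReal (64 * (8 * δ ^ 3 * Y ^ 3)) := by
          rw [Finset.sum_const, nsmul_eq_mul, ENNReal.ofReal_mul (p := 64) (by norm_num), hI]
          congr 1
          simp
      _ ≤ _ := by
          apply ENNReal.ofReal_le_ofReal
          have h1 : 64 * (8 * δ ^ 3 * Y ^ 3) = (K * δ ^ (-(2 * η)) * e / lam ^ 2) ^ 3 / 512 := by
            rw [hY]
            field_simp
            ring
          rw [h1]
          have : 0 ≤ (K * δ ^ (-(2 * η)) * e / lam ^ 2) ^ 3 := by positivity
          linarith
  have hE2 : volume E = ENNReal.ofReal e := (ENNReal.ofReal_toReal hEtop).symm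
  calc ENNReal.ofReal lam * volume F ^ (1 / 6 : ℝ)
      ≤ ENNReal.ofReal lam *
          ENNReal.ofReal ((K * δ ^ (-(2 * η)) * e / lam ^ 2) ^ 3) ^ (1 / 6 : ℝ) := by gcongr
    _ = ENNReal.ofReal (√K * δ ^ (-η)) * volume E ^ (1 / 2 : ℝ) := by
        rw [hE2, ENNReal.ofReal_rpow_of_nonneg (by positivity) (by norm_num),
          ENNReal.ofReal_rpow_of_nonneg he0 (by norm_num), ← ENNReal.ofReal_mul hlam.le,
          ← ENNReal.ofReal_mul (by positivity)]
        congr 1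
        rw [← Real.rpow_natCast, ← Real.rpow_mul (by positivity)]
        norm_num
        rw [Real.div_rpow (by positivity) (by positivity), Real.mul_rpow (by positivity) he0,
          Real.mul_rpow hK.le (by positivity), ← Real.rpow_mul hδ.le, ← Real.sqrt_eq_rpow,
          ← Real.sqrt_eq_rpow (lam ^ 2), Real.sqrt_sq hlam.le]
        rw [show -(2 * η) * (1 / 2) = -η by ring]
        field_simp

theorem mainTheorem3 :
    (∀ η : ℝ, 0 < η → η < 1 → ∃ δ₀ : ℝ, 0 < δ₀ ∧ ∀ δ : ℝ, 0 < δ → δ < δ₀ →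
      ∀ 𝒞 : Finset PlaneCircle, 𝒞.Nonempty → IsSeparatedCircleFamily δ 𝒞 →
        ∃ 𝒜 : Finset PlaneCircle, 𝒜 ⊆ 𝒞 ∧ (𝒜.card : ℝ) > η * (𝒞.card : ℝ) ∧
          ∀ C ∈ 𝒜, ∀ lam : ℝ, 0 < lam → lam < 1 →
            volume {y ∈ annulus δ C |
                circleMultiplicity δ 𝒜 y > δ ^ (-(4 * η)) * lam⁻¹ * (𝒜.card : ℝ) ^ (2 / 3 : ℝ)}
              ≤ ENNReal.ofReal lam * volume (annulus δ C)) ∧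
    (∀ η : ℝ, 0 < η → ∃ K : ℝ, 0 < K ∧ ∀ δ : ℝ, 0 < δ → δ < 1 →
      ∀ E : Set Plane, NullMeasurableSet E volume → (∀ y ∈ E, ∀ i, y i ∈ Set.Icc (0 : ℝ) 1) →
        ∀ lam : ℝ, 0 < lam →
          ENNReal.ofReal lam * volume (circularMeanSuperlevel δ lam E) ^ (1 / 6 : ℝ)
            ≤ ENNReal.ofReal (K * δ ^ (-η)) * volume E ^ (1 / 2 : ℝ)) :=
  ⟨fun _ hη hη1 => exists_subfamily_multiplicity_le hη hη1,
    fun _ hη => circularMean_restricted_weak_type hη⟩
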